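/- Let $n\ge 1$. In the exists-equal game $\mathrm{EE}_n$, Alice receives $x\in[4n]^n$ and Bob receives $y\in[4n]^n$, where $[4n]=\{1,\dots,4n\}$; the value of the game is $1$ if $x_i=y_i$ for some coordinate $i$, and $0$ otherwise. In an $r$-round randomized protocol the two players take at most $r$ turns, alternately sending each other messages that are bit strings (either player may start); the last player to receive a message declares the output (if no message is sent, the player who would have started does), and all actions may depend on a common random source. The protocol has error at most $1/3$ if for every pair of inputs $(x,y)$ the output differs from $\mathrm{EE}_n(x,y)$ with probability at most $1/3$. Put $\log^{(0)}x=x$ and $\log^{(r)}x=\log_2(\log^{(r-1)}x)$ for $r\ge 1$, and let $\log^* x$ be the smallest integer $r\ge 0$ with $\log^{(r)}x<2$. Corollary. For every constant $C$ there is a constant $K$, depending only on $C$, such that for every $n\ge 1$, every randomized protocol for $\mathrm{EE}_n$ with error at most $1/3$ in which each message has at most $Cn$ bits has at least $\log^* n-K$ rounds. -/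

import Mathlib

open MeasureTheory

universe u

/-! ### Two-player communication protocols -/

/-- A message of at most `c` bits. -/
abbrev Msg (c : ℕ) : Type := {w : List Bool // w.length ≤ c}

/-- Deterministic two-player protocols in which the players take at most `r` turns, alternately
sending each other messages of at most `c` bits; both inputs come from `X`.
The player whose turn it is either declares the output (`output`; unless the protocol has just
started, this is the player who received the last message), or sends a message computed from
the player's own input (`speak`), after which it is the turn of the other player and the protocol
continues in a way that depends on the message that was sent. -/
inductive DetProtocol (X : Type) (c : ℕ) : ℕ → Type where
  | output {r : ℕ} (g : X → Bool) : DetProtocol X c r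
  | speak {r : ℕ} (msg : X → Msg c) (next : Msg c → DetProtocol X c r) : DetProtocol X c (r + 1)

/-- The output of a deterministic protocol, where `a` is the input of the player whose turn it is
and `b` is the input of the other player. -/
def DetProtocol.run {X : Type} {c : ℕ} : {r : ℕ} → DetProtocol X c r → X → X → Bool
  | _, .output g, a, _ => g a
  | _, .speak msg next, a, b => (next (msg a)).run b a

/-- Randomized two-player protocols (common random source model) with at most `r` turns and
messages of at most `c` bits: the common random string `ω` is drawn from a probability space
and determines the deterministic protocol that the players follow. -/
structure RandProtocol (X : Type) (c r : ℕ) : Type (u + 1) where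
  /-- the sample space of the common random source -/
  Coins : Type u
  [mCoins : MeasurableSpace Coins]
  /-- the distribution of the common random source -/
  law : Measure Coins
  [prob : IsProbabilityMeasure law]
  /-- whether Alice is the player whose turn is first (otherwise Bob is) -/
  aliceFirst : Bool
  /-- the protocol followed for given coins -/
  det : Coins → DetProtocol X c r
  /-- the output is a random variable, for each pair of inputs -/
  measurable_run : ∀ a b : X, MeasurableSet {ω | (det ω).run a b = true}

attribute [instance] RandProtocol.mCoins RandProtocol.prob

namespace RandProtocol

/-- The output on Alice's input `x` and Bob's input `y` when the random source yields `ω`. -/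
def out {X : Type} {c r : ℕ} (P : RandProtocol X c r) (ω : P.Coins) (x y : X) : Bool :=
  if P.aliceFirst then (P.det ω).run x y else (P.det ω).run y x

/-- The protocol computes `f` with error probability at most `ε` on every pair of inputs. -/
def HasError {X : Type} {c r : ℕ} (P : RandProtocol X c r) (f : X → X → Bool) (ε : ℝ) : Prop :=
  ∀ x y : X, P.law.real {ω | P.out ω x y ≠ f x y} ≤ ε

end RandProtocol

/-! ### The exists-equal game -/

/-- The exists-equal game with parameters `t` and `n`, on vectors `x`, `y` from `[t]^n`:
the value is one if and only if `x i = y i` for some coordinate `i`. -/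
def existsEqual (t n : ℕ) (x y : Fin n → Fin t) : Bool := decide (∃ i, x i = y i)

/-! ### Iterated logarithms -/

/-- The `r`-fold iterate of the logarithm to base 2. -/
noncomputable def iterLog (r : ℕ) (x : ℝ) : ℝ := (Real.logb 2)^[r] x

/-- The least `r` for which the `r`-fold iterated logarithm of `x` is less than 2
(such an `r` exists by `exists_iterLog_lt_two`). -/
noncomputable def logStar (x : ℝ) : ℕ := sInf {r : ℕ | iterLog r x < 2}

theorem logb_two_le_sub_one {x : ℝ} (hx : 2 ≤ x) : Real.logb 2 x ≤ x - 1 := by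
  have h : x ≤ (2 : ℝ) ^ (x - 1) := by
    have := one_add_mul_self_le_rpow_one_add (s := 1) (by norm_num) (p := x - 1) (by linarith)
    norm_num at this
    linarith
  rw [Real.logb_le_iff_le_rpow (by norm_num) (by linarith)]
  exact h

theorem exists_iterLog_lt_two (x : ℝ) : ∃ r : ℕ, iterLog r x < 2 := by
  by_contra! H
  have key : ∀ r : ℕ, iterLog r x ≤ x - r := by
    intro r
    induction r with
    | zero => simp [iterLog]
    | succ k ih =>
      have h1 := logb_two_le_sub_one (H k)
      have h2 : iterLog (k + 1) x = Real.logb 2 (iterLog k x) := by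
        simp only [iterLog, Function.iterate_succ_apply']
      rw [h2]
      push_cast
      linarith
  obtain ⟨N, hN⟩ := exists_nat_gt x
  linarith [key N, H N]

open scoped BigOperators

/-! ### Averages -/

/-! The proof is round elimination on uniform inputs with `n = 2 ^ k` coordinates from `[2n]`.
Without communication the error exceeds 39/100. If messages have at most `2 ^ m` bits per
coordinate, a first message can be deleted by passing to `n / 2 ^ b` coordinates with `b` about `4 ^
m`, at the price of `3 / 2 ^ m` in error. Message lengths do not change, so the logarithm of the
number of bits per coordinate grows from `m` to at most `8 ^ m`. Iterating produces a tower, whence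
about `log* n` rounds.

To delete a message, fix it to a popular value among the inputs of nearly average error; this leaves
a dense set `S`. By `exists_shatters`, `S` contains the leaves of a tree that branches into `q`
children on all but `e` levels. Hence (`Shatters.exists_map`) `S` contains the image of a power of a
`q`-set `C` under a map that moves each branching coordinate by a permutation depending on earlier
coordinates only.

The branching levels are cut into blocks, each carrying one coordinate of the smaller game. With
public random permutations `g i`, Bob encodes his label `v` as the vector `g i v`, which is uniform.
Alice encodes her label `u` by a vector over `C` that equals `g i u` at one random hit (a position
with `g i u ∈ C`) and avoids the images of all labels elsewhere. The result is close in law to a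
uniform vector over `C` against a uniform vector over the whole alphabet
(`blockOutcome_average_le`).

Alice's vector must still be moved into `S` by permutations `θ` unknown to Bob. But `g ↦ θ * g` is
triangular, hence bijective (`twist_bijective`), so Alice alone can compensate for it
(`exists_embedding`). Averaging fixes the public randomness. -/

theorem expect_eq_expect_fiber {G S : Type*} [DecidableEq S] (T : Finset G)
    (A : Finset S) (f : G → S) (hf : ∀ g ∈ T, f g ∈ A)
    (hc : ∀ s ∈ A, ∀ s' ∈ A, (T.filter (f · = s)).card = (T.filter (f · = s')).card)
    (H : G → ℝ) :
    (𝔼 g ∈ T, H g) = 𝔼 s ∈ A, 𝔼 g ∈ T.filter (f · = s), H g := by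
  rcases A.eq_empty_or_nonempty with rfl | ⟨s₀, hs₀⟩
  · have : T = ∅ := by
      ext g
      simpa using fun h => hf g h
    simp [this]
  have hcard : T.card = A.card * (T.filter (f · = s₀)).card := by
    rw [Finset.card_eq_sum_card_fiberwise (f := f) (t := A) (fun g hg => hf g hg)]
    rw [Finset.sum_congr rfl fun s hs => hc s hs s₀ hs₀]
    simp
  rw [Finset.expect_eq_sum_div_card, Finset.expect_eq_sum_div_card, hcard,
    ← Finset.sum_fiberwise_of_maps_to hf, Nat.cast_mul, mul_comm, ← div_div,
    Finset.sum_div]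
  congr 1
  refine Finset.sum_congr rfl fun s hs => ?_
  rw [Finset.expect_eq_sum_div_card, hc s hs s₀ hs₀]

theorem expect_eq_expect_comp {G S : Type*} [DecidableEq S] (T : Finset G)
    (A : Finset S) (f : G → S) (hf : ∀ g ∈ T, f g ∈ A)
    (hc : ∀ s ∈ A, ∀ s' ∈ A, (T.filter (f · = s)).card = (T.filter (f · = s')).card)
    (hT : T.Nonempty) (H : S → ℝ) :
    (𝔼 g ∈ T, H (f g)) = 𝔼 s ∈ A, H s := by
  rw [expect_eq_expect_fiber T A f hf hc]
  refine Finset.expect_congr rfl fun s hs => ?_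
  obtain ⟨g, hg⟩ := hT
  have hne : (T.filter (f · = s)).Nonempty := by
    rw [← Finset.card_pos, hc s hs (f g) (hf g hg), Finset.card_pos]
    exact ⟨g, by simp [hg]⟩
  rw [Finset.expect_congr rfl (g := fun _ => H s), Finset.expect_const hne]
  intro g hg
  rw [(Finset.mem_filter.mp hg).2]

theorem expect_fin_succ {A : Type*} [Fintype A] {n : ℕ} (F : (Fin (n + 1) → A) → ℝ) :
    (𝔼 f, F f) = 𝔼 a, 𝔼 s : Fin n → A, F (Fin.cons a s) := by
  rw [← Finset.expect_product' Finset.univ Finset.univ fun a s => F (Fin.cons a s)]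
  symm
  exact Fintype.expect_equiv (Fin.consEquiv fun _ => A) _ _ fun _ => rfl

/-! ### One block -/

section Block

set_option linter.unusedSectionVars false

variable {α γ : Type} [Fintype α] [DecidableEq α] [Fintype γ] [DecidableEq γ]

/-- The number of positions before `i` where `r` takes a value in `C`. -/
def hitRank (C : Finset α) {B : ℕ} (r : Fin B → α) (i : Fin B) : ℕ :=
  (Finset.univ.filter fun j => j < i ∧ r j ∈ C).card

/-- The set consisting of the position of the hit of rank `k`, or of no position. -/
def target (C : Finset α) {B : ℕ} (r : Fin B → α) (k : ℕ) : Finset (Fin B) :=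
  Finset.univ.filter fun i => r i ∈ C ∧ hitRank C r i = k

/-- An element of `C` that is not the image under `g` of a label. -/
noncomputable def filler [Nonempty α] (ι : γ → α) (C : Finset α) (g : Equiv.Perm α) : α :=
  g (Classical.epsilon fun i => g i ∈ C ∧ i ∉ Set.range ι)

/-- The vector in `C ^ B` of a player with label `a`: it agrees with the image of the label at the
hit of rank `k` and avoids the images of all labels elsewhere. -/
noncomputable def blockVec [Nonempty α] (ι : γ → α) (C : Finset α) {B : ℕ} (a : γ) (k : ℕ)
    (g : Fin B → Equiv.Perm α) (i : Fin B) : α :=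
  if i ∈ target C (fun j => g j (ι a)) k then g i (ι a) else filler ι C (g i)

/-- The values at position `i` that agree with `r` on `m` and avoid `r` elsewhere. -/
def pinned (C : Finset α) {B : ℕ} (r : Fin B → α) (m : Finset (Fin B)) (i : Fin B) : Finset α :=
  if i ∈ m then {r i} else C.erase (r i)

variable [Nonempty α] {ι : γ → α} {C : Finset α} {B : ℕ}

/-- More than `|γ|` indices are mapped into `C`, so one of them is not a label. Avoiding every label
image lets Alice exclude agreement without knowing Bob's label. -/
theorem filler_spec (hι : Function.Injective ι) (hC : Fintype.card γ < C.card)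
    (g : Equiv.Perm α) : filler ι C g ∈ C ∧ ∀ b, filler ι C g ≠ g (ι b) := by
  classical
  have hex : ∃ i, g i ∈ C ∧ i ∉ Set.range ι := by
    by_contra! H
    have : (C.map g.symm.toEmbedding) ⊆ Finset.univ.image ι := by
      intro i hi
      simp only [Finset.mem_map_equiv, Equiv.symm_symm] at hi
      obtain ⟨b, rfl⟩ := H i hi
      simp
    have h := Finset.card_le_card this
    rw [Finset.card_map, Finset.card_image_of_injective _ hι, Finset.card_univ] at h
    omega
  have h := Classical.epsilon_spec hex
  refine ⟨h.1, fun b hb => h.2 ⟨b, ?_⟩⟩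
  exact (g.injective hb).symm

/-- `filler` chooses an index before `g` is applied, by a predicate that `τ` does not affect; the
same index is therefore chosen on both sides. -/
theorem filler_mul (τ g : Equiv.Perm α) (hτ : ∀ x, τ x ∈ C ↔ x ∈ C) :
    filler ι C (τ * g) = τ (filler ι C g) := by
  simp [filler, hτ]

theorem hitRank_congr {r r' : Fin B → α} {i : Fin B} (h : ∀ j < i, (r j ∈ C ↔ r' j ∈ C)) :
    hitRank C r i = hitRank C r' i := by
  unfold hitRank
  congr 1
  ext j
  simp only [Finset.mem_filter, Finset.mem_univ, true_and]
  exact and_congr_right fun hj => h j hj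

theorem mem_target_congr {r r' : Fin B → α} {i : Fin B} {k : ℕ}
    (h : ∀ j ≤ i, (r j ∈ C ↔ r' j ∈ C)) : i ∈ target C r k ↔ i ∈ target C r' k := by
  simp only [target, Finset.mem_filter, Finset.mem_univ, true_and]
  rw [h i le_rfl, hitRank_congr fun j hj => h j hj.le]

theorem blockVec_mul (τ g : Fin B → Equiv.Perm α) (hτ : ∀ i x, τ i x ∈ C ↔ x ∈ C) (a : γ) (k : ℕ) :
    blockVec ι C a k (τ * g) = fun i => τ i (blockVec ι C a k g i) := by
  ext i
  unfold blockVec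
  simp only [mem_target_congr (r := fun j => (τ * g) j (ι a)) (r' := fun j => g j (ι a))
    (C := C) (i := i) (k := k) (fun j _ => by simp [hτ])]
  split_ifs
  · simp
  · simp [filler_mul _ _ (hτ i)]

/-- Ranks count earlier hits only. This causality is what makes the twist triangular in
`twist_bijective`. -/
theorem blockVec_congr {g g' : Fin B → Equiv.Perm α} {i : Fin B} (h : ∀ j ≤ i, g j = g' j)
    (a : γ) (k : ℕ) : blockVec ι C a k g i = blockVec ι C a k g' i := by
  unfold blockVec
  simp only [mem_target_congr (r := fun j => g j (ι a)) (r' := fun j => g' j (ι a))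
    (C := C) (i := i) (k := k) (fun j hj => by rw [h j hj]), h i le_rfl]

theorem blockVec_mem (hι : Function.Injective ι) (hC : Fintype.card γ < C.card) (a b : γ) (k : ℕ)
    (g : Fin B → Equiv.Perm α) :
    blockVec ι C a k g ∈ Fintype.piFinset
      (pinned C (fun i => g i (ι b)) (if a = b then target C (fun i => g i (ι b)) k else ∅)) := by
  rw [Fintype.mem_piFinset]
  intro i
  obtain ⟨h1, h2⟩ := filler_spec hι hC (g i)
  unfold blockVec pinned
  by_cases hab : a = b
  · subst hab
    simp only [if_true]
    split_ifs with h <;> simp [h1, h2]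
  · simp only [hab, if_false, Finset.notMem_empty, Finset.mem_erase]
    split_ifs with h
    · refine ⟨fun h' => hab (hι ((g i).injective h')), ?_⟩
      exact (Finset.mem_filter.mp h).2.1
    · exact ⟨h2 b, h1⟩

theorem card_filter_apply_eq (c : α) (r r' : Fin B → α) :
    (Finset.univ.filter fun g : Fin B → Equiv.Perm α => (fun i => g i c) = r).card =
      (Finset.univ.filter fun g : Fin B → Equiv.Perm α => (fun i => g i c) = r').card := by
  classical
  refine Finset.card_bij' (fun g _ => (fun i => Equiv.swap (r i) (r' i)) * g)
    (fun g _ => (fun i => Equiv.swap (r i) (r' i)) * g) ?_ ?_ ?_ ?_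
  · intro g hg
    simp only [Finset.mem_filter, Finset.mem_univ, true_and] at hg ⊢
    ext i
    simp [congrFun hg i]
  · intro g hg
    simp only [Finset.mem_filter, Finset.mem_univ, true_and] at hg ⊢
    ext i
    simp [congrFun hg i]
  · intro g _
    ext i : 2
    simp
  · intro g _
    ext i : 2
    simp

/-- Given Bob's vector `r`, Alice's vector is uniform on a box that depends on the labels only
through their equality: composing with transpositions of `s i` and `s' i` exchanges the outcomes `s`
and `s'` without changing `r`. -/
theorem expect_blockVec (hι : Function.Injective ι) (hC : Fintype.card γ < C.card) (a b : γ) (k : ℕ)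
    (H : (Fin B → α) → (Fin B → α) → ℝ) :
    (𝔼 g : Fin B → Equiv.Perm α, H (blockVec ι C a k g) fun i => g i (ι b)) =
      𝔼 r : Fin B → α, 𝔼 s ∈ Fintype.piFinset
        (pinned C r (if a = b then target C r k else ∅)), H s r := by
  classical
  rw [expect_eq_expect_fiber Finset.univ Finset.univ (fun g : Fin B → Equiv.Perm α =>
    fun i => g i (ι b)) (fun _ _ => Finset.mem_univ _)
    (fun r _ r' _ => card_filter_apply_eq (ι b) r r')]
  refine Finset.expect_congr rfl fun r _ => ?_
  rw [← expect_eq_expect_comp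
    (Finset.univ.filter fun g : Fin B → Equiv.Perm α => (fun i => g i (ι b)) = r) _
    (blockVec ι C a k) ?_ ?_ ?_ (fun s => H s r)]
  · refine Finset.expect_congr rfl fun g hg => ?_
    rw [(Finset.mem_filter.mp hg).2]
  · intro g hg
    have := blockVec_mem hι hC a b k g
    rwa [(Finset.mem_filter.mp hg).2] at this
  · intro s hs s' hs'
    set m := if a = b then target C r k else ∅ with hm
    -- At a pinned position `s i = s' i = r i` and the swap is trivial; elsewhere both values lie in
    -- `C` and differ from `r i`.
    have key : ∀ i, Equiv.swap (s i) (s' i) (r i) = r i ∧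
        ∀ x, Equiv.swap (s i) (s' i) x ∈ C ↔ x ∈ C := by
      intro i
      have h1 := Fintype.mem_piFinset.mp hs i
      have h2 := Fintype.mem_piFinset.mp hs' i
      unfold pinned at h1 h2
      split_ifs at h1 h2 with h
      · simp only [Finset.mem_singleton] at h1 h2
        simp [h1, h2]
      · simp only [Finset.mem_erase] at h1 h2
        refine ⟨Equiv.swap_apply_of_ne_of_ne h1.1.symm h2.1.symm, fun x => ?_⟩
        rw [Equiv.swap_apply_def]
        split_ifs with h3 h4
        · simp [h3, h1.2, h2.2]
        · simp [h4, h1.2, h2.2]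
        · rfl
    have inv : ∀ g : Fin B → Equiv.Perm α,
        (fun i => Equiv.swap (s i) (s' i)) * ((fun i => Equiv.swap (s i) (s' i)) * g) = g := by
      intro g
      ext i : 2
      simp
    refine Finset.card_bij' (fun g _ => (fun i => Equiv.swap (s i) (s' i)) * g)
      (fun g _ => (fun i => Equiv.swap (s i) (s' i)) * g) ?_ ?_ (fun g _ => inv g)
      (fun g _ => inv g)
    · intro g hg
      simp only [Finset.mem_filter, Finset.mem_univ, true_and] at hg ⊢
      refine ⟨?_, ?_⟩
      · ext i
        simp [congrFun hg.1 i, (key i).1]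
      · rw [blockVec_mul _ _ fun i => (key i).2, hg.2]
        ext i
        simp
    · intro g hg
      simp only [Finset.mem_filter, Finset.mem_univ, true_and] at hg ⊢
      refine ⟨?_, ?_⟩
      · ext i
        simp [congrFun hg.1 i, (key i).1]
      · rw [blockVec_mul _ _ fun i => (key i).2, hg.2]
        ext i
        simp
  · rw [← Finset.card_pos, ← card_filter_apply_eq (ι b) (fun i => (1 : Equiv.Perm α) (ι b)) r,
      Finset.card_pos]
    exact ⟨1, Finset.mem_filter.mpr ⟨Finset.mem_univ _, rfl⟩⟩

end Block

/-! ### Agreement patterns against a fixed second vector -/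

section Compare

set_option linter.unusedSectionVars false

variable {α γ : Type} [Fintype α] [DecidableEq α] [Fintype γ] [DecidableEq γ]
variable {ι : γ → α} {C : Finset α} {B : ℕ}

/-- The positions where `r` takes a value in `C`. -/
def hits (C : Finset α) {B : ℕ} (r : Fin B → α) : Finset (Fin B) :=
  Finset.univ.filter fun i => r i ∈ C

theorem hitRank_lt {r : Fin B → α} {i j : Fin B} (hi : i ∈ hits C r) (hij : i < j) :
    hitRank C r i < hitRank C r j := by
  refine Finset.card_lt_card (Finset.ssubset_iff_of_subset ?_ |>.mpr ⟨i, ?_, ?_⟩)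
  · intro l hl
    simp only [Finset.mem_filter, Finset.mem_univ, true_and] at hl ⊢
    exact ⟨hl.1.trans hij, hl.2⟩
  · simpa [hij, hits] using hi
  · simp

theorem hitRank_injOn (r : Fin B → α) : Set.InjOn (hitRank C r) (hits C r) := by
  intro i hi j hj h
  rcases lt_trichotomy i j with hij | hij | hij
  · exact absurd h (hitRank_lt hi hij).ne
  · exact hij
  · exact absurd h (hitRank_lt hj hij).ne'

theorem image_hitRank (r : Fin B → α) :
    (hits C r).image (hitRank C r) = Finset.range (hits C r).card := by
  refine Finset.eq_of_subset_of_card_le ?_ ?_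
  · intro k hk
    obtain ⟨i, hi, rfl⟩ := Finset.mem_image.mp hk
    rw [Finset.mem_range]
    refine Finset.card_lt_card (Finset.ssubset_iff_of_subset ?_ |>.mpr ⟨i, hi, ?_⟩)
    · intro l hl
      simp only [Finset.mem_filter, Finset.mem_univ, true_and, hits] at hl ⊢
      exact hl.2
    · simp
  · rw [Finset.card_image_of_injOn (hitRank_injOn r), Finset.card_range]

theorem target_hitRank {r : Fin B → α} {i : Fin B} (hi : i ∈ hits C r) :
    target C r (hitRank C r i) = {i} := by
  ext j
  simp only [target, Finset.mem_filter, Finset.mem_univ, true_and, Finset.mem_singleton]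
  constructor
  · rintro ⟨h1, h2⟩
    exact hitRank_injOn r (by simpa [hits] using h1) hi h2
  · rintro rfl
    exact ⟨by simpa [hits] using hi, rfl⟩

/-- Ranks enumerate the hits without repetition. A rank beyond the number of hits has an empty
target and costs at most one. -/
theorem sum_target_le (r : Fin B → α) (K : ℕ) (G : Finset (Fin B) → ℝ) (h1 : ∀ m, G m ≤ 1) :
    ∑ k ∈ Finset.range K, G (target C r k) ≤
      (∑ i ∈ (hits C r).filter (hitRank C r · < K), G {i}) + ((K - (hits C r).card : ℕ) : ℝ) := by
  rw [← Finset.sum_filter_add_sum_filter_not _ (· < (hits C r).card)]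
  refine add_le_add (le_of_eq ?_) ?_
  · have : (Finset.range K).filter (· < (hits C r).card) =
        ((hits C r).filter (hitRank C r · < K)).image (hitRank C r) := by
      have h := Finset.filter_image (s := hits C r) (f := hitRank C r) (p := (· < K))
      rw [← h, image_hitRank]
      ext k
      simp [and_comm]
    rw [this, Finset.sum_image]
    · refine Finset.sum_congr rfl fun i hi => ?_
      rw [target_hitRank (Finset.mem_filter.mp hi).1]
    · exact (hitRank_injOn r).mono (by intro i hi; exact (Finset.mem_filter.mp hi).1)
  · refine (Finset.sum_le_card_nsmul _ _ 1 fun k _ => h1 _).trans ?_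
    rw [nsmul_eq_mul, mul_one]
    have : (Finset.range K).filter (fun k => ¬ k < (hits C r).card) =
        Finset.Ico (hits C r).card K := by
      ext k
      simp [and_comm]
    rw [this, Nat.card_Ico]

theorem card_filter_hitRank_le (r : Fin B → α) (K : ℕ) :
    ((hits C r).filter (hitRank C r · < K)).card ≤ K := by
  have h := Finset.card_le_card_of_injOn (s := (hits C r).filter (hitRank C r · < K))
    (t := Finset.range K) (hitRank C r) ?_ ?_
  · simpa using h
  · intro i hi
    simpa using (Finset.mem_filter.mp hi).2
  · exact (hitRank_injOn r).mono (by intro i hi; exact (Finset.mem_filter.mp hi).1)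

theorem filter_agree_eq_pinned {r : Fin B → α} {m : Finset (Fin B)} (hm : m ⊆ hits C r) :
    ((Fintype.piFinset fun _ : Fin B => C).filter fun s =>
      (Finset.univ.filter fun i => s i = r i) = m) = Fintype.piFinset (pinned C r m) := by
  ext s
  simp only [Finset.mem_filter, Fintype.mem_piFinset, pinned]
  constructor
  · rintro ⟨h, rfl⟩ i
    by_cases hi : s i = r i
    · simp [hi]
    · simp [hi, h i]
  · intro h
    have h' : ∀ i, s i = r i ↔ i ∈ m := by
      intro i
      have := h i
      split_ifs at this with him
      · simp [him, Finset.mem_singleton.mp this]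
      · simp [him, (Finset.mem_erase.mp this).1]
    refine ⟨fun i => ?_, ?_⟩
    · have := h i
      split_ifs at this with him
      · rw [Finset.mem_singleton.mp this]
        simpa [hits] using hm him
      · exact (Finset.mem_erase.mp this).2
    · ext i
      simp [h' i]

theorem card_pinned_div {r : Fin B → α} {m : Finset (Fin B)} (hm : m ⊆ hits C r)
    (hC : 0 < C.card) :
    ((Fintype.piFinset (pinned C r m)).card : ℝ) / (C.card : ℝ) ^ B =
      (1 / (C.card : ℝ)) ^ m.card * (1 - 1 / (C.card : ℝ)) ^ ((hits C r).card - m.card) := by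
  have hC' : (C.card : ℝ) ≠ 0 := by positivity
  rw [Fintype.card_piFinset, Nat.cast_prod]
  have : (C.card : ℝ) ^ B = ∏ _i : Fin B, (C.card : ℝ) := by simp
  rw [this, ← Finset.prod_div_distrib, ← Finset.card_sdiff_of_subset hm,
    ← Finset.prod_const, ← Finset.prod_const]
  rw [← Finset.prod_subset (Finset.subset_univ (hits C r)), ← Finset.prod_sdiff hm, mul_comm]
  · congr 1
    · refine Finset.prod_congr rfl fun i hi => ?_
      simp [pinned, hi]
    · refine Finset.prod_congr rfl fun i hi => ?_
      have hi' := Finset.mem_sdiff.mp hi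
      have h2 : r i ∈ C := by simpa [hits] using hi'.1
      simp only [pinned, hi'.2, if_false]
      rw [Finset.card_erase_of_mem h2, Nat.cast_sub hC]
      field_simp
      simp
  · intro i _ hi
    have h2 : r i ∉ C := by simpa [hits] using hi
    have h3 : i ∉ m := fun h => hi (hm h)
    simp only [pinned, h3, if_false]
    rw [Finset.erase_eq_of_notMem h2, div_self hC']

/-- Split `C ^ B` by the set of positions that agree with `r`: each class is a pinned box of known
density. Classes with two or more agreements are dropped, being nonnegative. -/
theorem sum_pinned_le_expect (r : Fin B → α) (hC : 0 < C.card) (Ψ : (Fin B → α) → Bool → ℝ)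
    (h0 : ∀ s e, 0 ≤ Ψ s e) :
    (1 - 1 / (C.card : ℝ)) ^ (hits C r).card *
        (𝔼 s ∈ Fintype.piFinset (pinned C r ∅), Ψ s false) +
      ∑ i ∈ hits C r, 1 / (C.card : ℝ) * (1 - 1 / (C.card : ℝ)) ^ ((hits C r).card - 1) *
        (𝔼 s ∈ Fintype.piFinset (pinned C r {i}), Ψ s true) ≤
      𝔼 s ∈ Fintype.piFinset fun _ : Fin B => C, Ψ s (decide (∃ i, s i = r i)) := by
  have key : ∀ m ⊆ hits C r, ∀ e,
      (1 / (C.card : ℝ)) ^ m.card * (1 - 1 / (C.card : ℝ)) ^ ((hits C r).card - m.card) *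
        (𝔼 s ∈ Fintype.piFinset (pinned C r m), Ψ s e) =
      (∑ s ∈ Fintype.piFinset (pinned C r m), Ψ s e) / (C.card : ℝ) ^ B := by
    intro m hm e
    rw [← card_pinned_div hm hC, Finset.expect_eq_sum_div_card]
    rcases (Fintype.piFinset (pinned C r m)).eq_empty_or_nonempty with h | h
    · simp [h]
    · have : ((Fintype.piFinset (pinned C r m)).card : ℝ) ≠ 0 := by
        have := Finset.card_pos.mpr h
        positivity
      field_simp
  have hinj : Set.InjOn (fun i : Fin B => ({i} : Finset (Fin B))) (hits C r) :=
    fun i _ j _ h => Finset.singleton_injective h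
  have hnot : (∅ : Finset (Fin B)) ∉ (hits C r).image fun i => {i} := by
    simp
  have hsum : ∑ m ∈ insert ∅ ((hits C r).image fun i => {i}),
      (∑ s ∈ Fintype.piFinset (pinned C r m), Ψ s (decide (∃ i, s i = r i))) / (C.card : ℝ) ^ B ≤
      𝔼 s ∈ Fintype.piFinset fun _ : Fin B => C, Ψ s (decide (∃ i, s i = r i)) := by
    rw [Finset.expect_eq_sum_div_card, Fintype.card_piFinset]
    simp only [Finset.prod_const, Finset.card_univ, Fintype.card_fin, Nat.cast_pow]
    rw [← Finset.sum_div]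
    refine div_le_div_of_nonneg_right ?_ (by positivity)
    rw [← Finset.sum_fiberwise (Fintype.piFinset fun _ : Fin B => C)
      (fun s => Finset.univ.filter fun i => s i = r i)]
    refine le_trans (le_of_eq ?_) (Finset.sum_le_sum_of_subset_of_nonneg (Finset.subset_univ
      (insert ∅ ((hits C r).image fun i => {i}))) fun m _ _ => Finset.sum_nonneg fun s _ => h0 _ _)
    refine Finset.sum_congr rfl fun m hm => ?_
    rw [filter_agree_eq_pinned]
    rcases Finset.mem_insert.mp hm with rfl | hm
    · simp
    · obtain ⟨i, hi, rfl⟩ := Finset.mem_image.mp hm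
      simpa using hi
  refine le_trans (le_of_eq ?_) hsum
  rw [Finset.sum_insert hnot, Finset.sum_image hinj]
  have hagree : ∀ m, ∀ s ∈ Fintype.piFinset (pinned C r m), ∀ i, s i = r i ↔ i ∈ m := by
    intro m s hs i
    have := Fintype.mem_piFinset.mp hs i
    unfold pinned at this
    split_ifs at this with him
    · simp [him, Finset.mem_singleton.mp this]
    · simp [him, (Finset.mem_erase.mp this).1]
  congr 1
  · have := key ∅ (Finset.empty_subset _) false
    simp only [Finset.card_empty, pow_zero, one_mul, Nat.sub_zero] at this
    rw [this]
    congr 1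
    refine Finset.sum_congr rfl fun s hs => ?_
    have h : ¬ ∃ i, s i = r i := by
      rintro ⟨i, hi⟩
      simpa using (hagree ∅ s hs i).mp hi
    simp only [h, decide_false]
  · refine Finset.sum_congr rfl fun j hj => ?_
    have := key {j} (by simpa using hj) true
    simp only [Finset.card_singleton, pow_one] at this
    rw [this]
    congr 1
    refine Finset.sum_congr rfl fun s hs => ?_
    have h : ∃ i, s i = r i := ⟨j, (hagree {j} s hs j).mpr (by simp)⟩
    simp only [h, decide_true]

theorem expect_mem_Icc {β : Type*} (s : Finset β) (f : β → ℝ) (h0 : ∀ x, 0 ≤ f x)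
    (h1 : ∀ x, f x ≤ 1) : 0 ≤ 𝔼 x ∈ s, f x ∧ 𝔼 x ∈ s, f x ≤ 1 := by
  refine ⟨Finset.expect_nonneg fun x _ => h0 x, ?_⟩
  rcases s.eq_empty_or_nonempty with rfl | h
  · simp
  · exact Finset.expect_le h fun x _ => h1 x

/-- The comparison for fixed second vector `r`. -/
theorem target_average_le (r : Fin B → α) (hC : 0 < C.card) (K : ℕ)
    (Ψ : (Fin B → α) → Bool → ℝ) (h0 : ∀ s e, 0 ≤ Ψ s e) (h1 : ∀ s e, Ψ s e ≤ 1) :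
    (1 - K / (C.card : ℝ)) * (𝔼 s ∈ Fintype.piFinset (pinned C r ∅), Ψ s false) +
      1 / (C.card : ℝ) * ∑ k ∈ Finset.range K,
        (𝔼 s ∈ Fintype.piFinset (pinned C r (target C r k)), Ψ s true) ≤
      (𝔼 s ∈ Fintype.piFinset fun _ : Fin B => C, Ψ s (decide (∃ i, s i = r i))) +
        |((hits C r).card : ℝ) - K| / C.card +
        K * (hits C r).card / (C.card : ℝ) ^ 2 := by
  have hA := sum_pinned_le_expect r hC Ψ h0
  have hG := fun m e => expect_mem_Icc (Fintype.piFinset (pinned C r m)) (Ψ · e)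
    (fun s => h0 s e) (fun s => h1 s e)
  have hT := sum_target_le (C := C) r K
    (fun m => 𝔼 s ∈ Fintype.piFinset (pinned C r m), Ψ s true) (fun m => (hG m true).2)
  have hN := card_filter_hitRank_le (C := C) r K
  set N := (hits C r).card with hNdef
  set q : ℝ := (C.card : ℝ) with hq
  have hq1 : (1 : ℝ) ≤ q := by
    rw [hq]
    exact_mod_cast hC
  have hq0 : 0 < q := by linarith
  set G : Finset (Fin B) → ℝ := fun m => 𝔼 s ∈ Fintype.piFinset (pinned C r m), Ψ s true with hGdef
  set G₀ : ℝ := 𝔼 s ∈ Fintype.piFinset (pinned C r ∅), Ψ s false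
  have hG0 : 0 ≤ G₀ ∧ G₀ ≤ 1 := hG ∅ false
  have hb : (-2 : ℝ) ≤ -(1 / q) := by
    have : 1 / q ≤ 1 := by rw [div_le_one hq0]; exact hq1
    linarith
  -- Bernoulli's inequality; replacing `N` by `K` afterwards costs `(N - K) / q` when `N` exceeds
  -- `K`.
  have hx : 1 - N / q ≤ (1 - 1 / q) ^ N := by
    have := one_add_mul_le_pow hb N
    calc 1 - N / q = 1 + N * (-(1 / q)) := by ring
      _ ≤ _ := this
      _ = _ := by ring
  set y : ℝ := (1 - 1 / q) ^ (N - 1)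
  have hy1 : y ≤ 1 := pow_le_one₀ (by
    have : 1 / q ≤ 1 := by rw [div_le_one hq0]; exact hq1
    linarith) (by
    have : 0 ≤ 1 / q := by positivity
    linarith)
  have hy : 1 - N / q ≤ y := by
    have := one_add_mul_le_pow hb (N - 1)
    have h2 : ((N - 1 : ℕ) : ℝ) ≤ N := by exact_mod_cast Nat.sub_le N 1
    calc 1 - N / q ≤ 1 - (N - 1 : ℕ) / q := by gcongr
      _ = 1 + (N - 1 : ℕ) * (-(1 / q)) := by ring
      _ ≤ _ := this
      _ = y := by simp only [y]; ring
  have hy0 : 0 ≤ y := pow_nonneg (by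
    have : 1 / q ≤ 1 := by rw [div_le_one hq0]; exact hq1
    linarith) _
  have e1 : (1 - K / q) * G₀ ≤ (1 - 1 / q) ^ N * G₀ + ((N - K : ℕ) : ℝ) / q := by
    have h3 : (N : ℝ) - K ≤ ((N - K : ℕ) : ℝ) := by
      rw [sub_le_iff_le_add]
      exact_mod_cast Nat.sub_le_iff_le_add.mp le_rfl
    have h4 : (1 - K / q) - (1 - 1 / q) ^ N ≤ ((N - K : ℕ) : ℝ) / q := by
      calc (1 - K / q) - (1 - 1 / q) ^ N ≤ (1 - K / q) - (1 - N / q) := by gcongr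
        _ = ((N : ℝ) - K) / q := by ring
        _ ≤ _ := by gcongr
    have h5 : 0 ≤ ((N - K : ℕ) : ℝ) / q := by positivity
    nlinarith [mul_le_mul_of_nonneg_right h4 hG0.1, mul_le_mul_of_nonneg_left hG0.2 h5]
  -- Each of at most `K` terms loses `1 - y ≤ N / q`; this is the source of the error `K * N / q ^
  -- 2`.
  have e2 : ∑ i ∈ (hits C r).filter (hitRank C r · < K), G {i} ≤
      (∑ i ∈ hits C r, y * G {i}) + K * (N / q) := by
    have h6 : ∀ i ∈ (hits C r).filter (hitRank C r · < K), G {i} ≤ y * G {i} + N / q := by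
      intro i _
      have := (hG {i} true)
      have h7 : 0 ≤ (1 - y) := by linarith
      have h8 : (1 - y) * G {i} ≤ (1 - y) * 1 := mul_le_mul_of_nonneg_left this.2 h7
      linarith
    refine (Finset.sum_le_sum h6).trans ?_
    rw [Finset.sum_add_distrib, Finset.sum_const, nsmul_eq_mul]
    refine add_le_add ?_ ?_
    · exact Finset.sum_le_sum_of_subset_of_nonneg (Finset.filter_subset _ _)
        fun i _ _ => mul_nonneg hy0 (hG {i} true).1
    · have : (((hits C r).filter (hitRank C r · < K)).card : ℝ) ≤ K := by exact_mod_cast hN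
      gcongr
  have e3 : ∑ i ∈ hits C r, 1 / q * y * G {i} = 1 / q * ∑ i ∈ hits C r, y * G {i} := by
    rw [Finset.mul_sum]
    exact Finset.sum_congr rfl fun i _ => by ring
  have e4 : |(N : ℝ) - K| = ((N - K : ℕ) : ℝ) + ((K - N : ℕ) : ℝ) := by
    rcases le_total N K with h | h
    · rw [Nat.sub_eq_zero_of_le h, Nat.cast_sub h, abs_of_nonpos (by simpa using h)]
      simp
    · rw [Nat.sub_eq_zero_of_le h, Nat.cast_sub h, abs_of_nonneg (by simpa using h)]
      simp
  have e5 : 1 / q * ∑ k ∈ Finset.range K, G (target C r k) ≤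
      1 / q * (((∑ i ∈ hits C r, y * G {i}) + K * (N / q)) + ((K - N : ℕ) : ℝ)) :=
    mul_le_mul_of_nonneg_left (hT.trans (by gcongr)) (by positivity)
  have e6 : 1 / q * (((∑ i ∈ hits C r, y * G {i}) + K * (N / q)) + ((K - N : ℕ) : ℝ)) =
      1 / q * (∑ i ∈ hits C r, y * G {i}) + K * N / q ^ 2 + ((K - N : ℕ) : ℝ) / q := by
    field_simp
  rw [e4, add_div]
  rw [e3] at hA
  linarith

end Compare

/-! ### Mean and variance of the number of hits -/

section Moments

set_option linter.unusedSectionVars false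

variable {α : Type} [Fintype α] [DecidableEq α] [Nonempty α]

theorem card_hits_cons (C : Finset α) {n : ℕ} (a : α) (s : Fin n → α) :
    ((hits C (Fin.cons a s : Fin (n + 1) → α)).card : ℝ) =
      (if a ∈ C then 1 else 0) + (hits C s).card := by
  unfold hits
  rw [Finset.card_filter, Finset.card_filter, Fin.sum_univ_succ]
  simp

theorem expect_mem (C : Finset α) :
    (𝔼 a : α, if a ∈ C then (1 : ℝ) else 0) = C.card / Fintype.card α := by
  rw [Fintype.expect_eq_sum_div_card]
  simp

theorem expect_card_hits (C : Finset α) (n : ℕ) :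
    (𝔼 r : Fin n → α, ((hits C r).card : ℝ)) = n * (C.card / Fintype.card α) := by
  induction n with
  | zero => simp [hits]
  | succ n ih =>
    rw [expect_fin_succ]
    simp only [card_hits_cons, Finset.expect_add_distrib, Fintype.expect_const, ih, expect_mem]
    push_cast
    ring

theorem expect_sq_card_hits_le (C : Finset α) (n : ℕ) :
    (𝔼 r : Fin n → α, ((hits C r).card - n * (C.card / Fintype.card α) : ℝ) ^ 2) ≤
      n * (C.card / Fintype.card α) := by
  have hq0 : (0 : ℝ) ≤ C.card / Fintype.card α := by positivity
  have hc : (0 : ℝ) < Fintype.card α := by exact_mod_cast Fintype.card_pos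
  induction n with
  | zero => simp [hits]
  | succ n ih =>
    have hm := expect_card_hits C n
    have h1 := expect_mem C
    set p : ℝ := C.card / Fintype.card α with hp
    rw [expect_fin_succ]
    have hsplit : ∀ (a : α) (s : Fin n → α),
        (((hits C (Fin.cons a s : Fin (n + 1) → α)).card : ℝ) - ((n + 1 : ℕ) : ℝ) * p) ^ 2 =
          ((if a ∈ C then (1 : ℝ) else 0) * (1 - 2 * p) + p ^ 2) +
          (2 * ((if a ∈ C then (1 : ℝ) else 0) - p)) * ((hits C s).card - n * p) +
          ((hits C s).card - n * p) ^ 2 := by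
      intro a s
      rw [card_hits_cons]
      push_cast
      split_ifs <;> ring
    simp only [hsplit, Finset.expect_add_distrib, Fintype.expect_const, ← Finset.mul_expect,
      Finset.expect_sub_distrib, hm, sub_self, mul_zero, add_zero, ← Finset.expect_mul, h1]
    push_cast
    nlinarith [sq_nonneg p]

/-- The variance is at most `K = l ^ 2`, and `|x| ≤ x ^ 2 / (2 * l) + l / 2` pointwise bounds the
deviation from the mean by `l`. The bias is at most `K * η`. -/
theorem expect_abs_card_hits_le (C : Finset α) (n : ℕ) {K l : ℝ} (hl : 0 < l) (hK : K = l ^ 2)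
    {η : ℝ} (h1 : n * (C.card / Fintype.card α : ℝ) ≤ K)
    (h2 : K * (1 - η) ≤ n * (C.card / Fintype.card α : ℝ)) :
    (𝔼 r : Fin n → α, |((hits C r).card : ℝ) - K|) ≤ l + K * η := by
  have hv := expect_sq_card_hits_le C n
  set p : ℝ := n * (C.card / Fintype.card α) with hp
  have hpt : ∀ r : Fin n → α, |((hits C r).card : ℝ) - K| ≤
      (1 / (2 * l)) * ((hits C r).card - p) ^ 2 + (l / 2 + K * η) := by
    intro r
    set N : ℝ := ((hits C r).card : ℝ)
    have h3 : |N - K| ≤ |N - p| + |p - K| := abs_sub_le N p K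
    have h4 : |p - K| ≤ K * η := by rw [abs_sub_comm, abs_of_nonneg (by linarith)]; linarith
    have h5 : |N - p| ≤ (1 / (2 * l)) * (N - p) ^ 2 + l / 2 := by
      rw [← sq_abs (N - p)]
      have : (1 / (2 * l)) * |N - p| ^ 2 + l / 2 - |N - p| = (1 / (2 * l)) * (|N - p| - l) ^ 2 := by
        field_simp
        ring
      have h6 : 0 ≤ (1 / (2 * l)) * (|N - p| - l) ^ 2 := by positivity
      linarith
    linarith
  refine (Finset.expect_le_expect fun r _ => hpt r).trans ?_
  rw [Finset.expect_add_distrib, ← Finset.mul_expect, Fintype.expect_const]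
  have : (1 / (2 * l)) * (𝔼 r : Fin n → α, ((hits C r).card - p : ℝ) ^ 2) ≤ (1 / (2 * l)) * l ^ 2 :=
    mul_le_mul_of_nonneg_left (by linarith) (by positivity)
  have h7 : (1 / (2 * l)) * l ^ 2 = l / 2 := by field_simp
  linarith

end Moments

theorem expect_ite_eq_le {γ : Type} [Fintype γ] [DecidableEq γ] [Nonempty γ] (P Q : ℝ) :
    (𝔼 a : γ, 𝔼 b : γ, if a = b then P else Q) =
      1 / (Fintype.card γ : ℝ) * P + (1 - 1 / (Fintype.card γ : ℝ)) * Q := by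
  have h : ∀ a b : γ, (if a = b then P else Q) = (if a = b then P - Q else 0) + Q := by
    intro a b
    split_ifs <;> ring
  simp only [h, Finset.expect_add_distrib, Fintype.expect_const]
  have h2 : ∀ a : γ, (𝔼 b : γ, if a = b then P - Q else 0) = 1 / (Fintype.card γ : ℝ) * (P - Q) := by
    intro a
    rw [Fintype.expect_eq_sum_div_card]
    simp
    ring
  simp only [h2, Fintype.expect_const]
  ring

/-! ### The encoded block compared with independent uniform vectors -/

section BlockAverage

set_option linter.unusedSectionVars false

variable {α γ : Type} [Fintype α] [DecidableEq α] [Nonempty α]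
  [Fintype γ] [DecidableEq γ] [Nonempty γ]

/-- The vectors of the two players in a block, and whether their labels agree, as a function of
the labels, the rank and the public permutations. -/
noncomputable def blockOutcome (ι : γ → α) (C : Finset α) {K B : ℕ}
    (ω : (γ × γ) × (Fin K × (Fin B → Equiv.Perm α))) : (Fin B → α) × (Fin B → α) × Bool :=
  (blockVec ι C ω.1.1 ω.2.1 ω.2.2, fun i => ω.2.2 i (ι ω.1.2), decide (ω.1.1 = ω.1.2))

/-- Two vectors, and whether they agree at some position. -/
def matchOutcome {C : Finset α} {B : ℕ} (ω : (Fin B → C) × (Fin B → α)) :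
    (Fin B → α) × (Fin B → α) × Bool :=
  (fun i => ω.1 i, ω.2, decide (∃ i, (ω.1 i : α) = ω.2 i))

theorem expect_subtype_pi (C : Finset α) {B : ℕ} (F : (Fin B → α) → ℝ) :
    (𝔼 s : Fin B → C, F fun i => s i) = 𝔼 s ∈ Fintype.piFinset fun _ : Fin B => C, F s := by
  refine Finset.expect_bij (fun s _ i => (s i : α)) ?_ ?_ ?_ ?_
  · intro s _
    simp
  · intro s _
    rfl
  · intro s _ s' _ h
    ext i
    exact congrFun h i
  · intro s hs
    exact ⟨fun i => ⟨s i, Fintype.mem_piFinset.mp hs i⟩, Finset.mem_univ _, rfl⟩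

/-- Uniform labels agree with probability `1 / |γ| = K / |C|`, and a uniform rank then gives the
left side of `target_average_le`, with the number of hits concentrated near `K`. Allowing every test
function into `[0, 1]` bounds total variation. -/
theorem blockOutcome_average_le {ι : γ → α} (hι : Function.Injective ι) {C : Finset α}
    (hC : Fintype.card γ < C.card) {K B : ℕ} (hK : C.card = K * Fintype.card γ)
    {l η : ℝ} (hl : 0 < l) (hKl : (K : ℝ) = l ^ 2)
    (h1 : B * (C.card / Fintype.card α : ℝ) ≤ K)
    (h2 : K * (1 - η) ≤ B * (C.card / Fintype.card α : ℝ))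
    (Ψ : (Fin B → α) × (Fin B → α) × Bool → ℝ) (hΨ0 : ∀ d, 0 ≤ Ψ d) (hΨ1 : ∀ d, Ψ d ≤ 1) :
    (𝔼 ω : (γ × γ) × (Fin K × (Fin B → Equiv.Perm α)), Ψ (blockOutcome ι C ω)) ≤
      (𝔼 ω : (Fin B → C) × (Fin B → α), Ψ (matchOutcome ω)) +
        ((l + K * η) / C.card + (K / C.card : ℝ) ^ 2) := by
  have hC0 : 0 < C.card := by omega
  have hq : (0 : ℝ) < C.card := by exact_mod_cast hC0
  have hK0 : 0 < K := by
    rcases Nat.eq_zero_or_pos K with h | h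
    · rw [h] at hK; omega
    · exact h
  have hγ : (0 : ℝ) < Fintype.card γ := by exact_mod_cast Fintype.card_pos
  have hKq : (K : ℝ) / C.card = 1 / Fintype.card γ := by
    rw [hK]
    have : (K : ℝ) ≠ 0 := by positivity
    push_cast
    field_simp
  have : Nonempty (Fin K) := ⟨⟨0, hK0⟩⟩
  set P : (Fin B → α) → ℝ := fun r => 1 / (K : ℝ) * ∑ k ∈ Finset.range K,
    (𝔼 s ∈ Fintype.piFinset (pinned C r (target C r k)), Ψ (s, r, true)) with hP
  set Q : (Fin B → α) → ℝ := fun r => 𝔼 s ∈ Fintype.piFinset (pinned C r ∅), Ψ (s, r, false) with hQ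
  have hL : (𝔼 ω : (γ × γ) × (Fin K × (Fin B → Equiv.Perm α)), Ψ (blockOutcome ι C ω)) =
      𝔼 r : Fin B → α, ((1 - K / (C.card : ℝ)) * Q r + 1 / (C.card : ℝ) * ∑ k ∈ Finset.range K,
        (𝔼 s ∈ Fintype.piFinset (pinned C r (target C r k)), Ψ (s, r, true))) := by
    have e1 : (𝔼 ω : (γ × γ) × (Fin K × (Fin B → Equiv.Perm α)), Ψ (blockOutcome ι C ω)) =
        𝔼 a : γ, 𝔼 b : γ, 𝔼 k : Fin K, 𝔼 g : Fin B → Equiv.Perm α,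
          Ψ (blockVec ι C a k g, fun i => g i (ι b), decide (a = b)) := by
      rw [← Finset.univ_product_univ, Finset.expect_product, ← Finset.univ_product_univ,
        Finset.expect_product]
      refine Finset.expect_congr rfl fun a _ => Finset.expect_congr rfl fun b _ => ?_
      rw [← Finset.univ_product_univ, Finset.expect_product]
      rfl
    rw [e1]
    have e2 : ∀ a b : γ, (𝔼 k : Fin K, 𝔼 g : Fin B → Equiv.Perm α,
          Ψ (blockVec ι C a k g, fun i => g i (ι b), decide (a = b))) =
        𝔼 r : Fin B → α, if a = b then P r else Q r := by
      intro a b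
      have e3 : ∀ k : Fin K, (𝔼 g : Fin B → Equiv.Perm α,
          Ψ (blockVec ι C a k g, fun i => g i (ι b), decide (a = b))) =
          𝔼 r : Fin B → α, 𝔼 s ∈ Fintype.piFinset
            (pinned C r (if a = b then target C r k else ∅)), Ψ (s, r, decide (a = b)) :=
        fun k => expect_blockVec hι hC a b k fun s r => Ψ (s, r, decide (a = b))
      simp only [e3]
      rw [Finset.expect_comm]
      refine Finset.expect_congr rfl fun r _ => ?_
      by_cases hab : a = b
      · simp only [hab, if_true, decide_true, hP]
        rw [Fintype.expect_eq_sum_div_card, Fintype.card_fin, Finset.sum_range]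
        ring
      · simp only [hab, if_false, decide_false, Fintype.expect_const, hQ]
    simp only [e2]
    have e4 : (𝔼 a : γ, 𝔼 b : γ, 𝔼 r : Fin B → α, if a = b then P r else Q r) =
        𝔼 r : Fin B → α, 𝔼 a : γ, 𝔼 b : γ, if a = b then P r else Q r := by
      rw [Finset.expect_comm]
      simp only [Finset.expect_comm (s := (Finset.univ : Finset γ))
        (t := (Finset.univ : Finset (Fin B → α)))]
      refine Finset.expect_congr rfl fun r _ => ?_
      rw [Finset.expect_comm]
    rw [e4]
    refine Finset.expect_congr rfl fun r _ => ?_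
    rw [expect_ite_eq_le, hKq, hP]
    have : 1 / (C.card : ℝ) = 1 / (Fintype.card γ : ℝ) * (1 / (K : ℝ)) := by
      rw [hK]
      push_cast
      field_simp
    rw [this]
    ring
  have hR : (𝔼 ω : (Fin B → C) × (Fin B → α), Ψ (matchOutcome ω)) =
      𝔼 r : Fin B → α, 𝔼 s ∈ Fintype.piFinset fun _ : Fin B => C,
        Ψ (s, r, decide (∃ i, s i = r i)) := by
    rw [← Finset.univ_product_univ, Finset.expect_product, Finset.expect_comm]
    refine Finset.expect_congr rfl fun r _ => ?_
    rw [← expect_subtype_pi]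
    rfl
  rw [hL, hR]
  refine (Finset.expect_le_expect fun r _ => target_average_le r hC0 K (fun s e => Ψ (s, r, e))
    (fun s e => hΨ0 _) (fun s e => hΨ1 _)).trans ?_
  rw [Finset.expect_add_distrib, Finset.expect_add_distrib, add_assoc]
  refine add_le_add le_rfl (add_le_add ?_ ?_)
  · rw [← Finset.expect_div]
    exact div_le_div_of_nonneg_right (expect_abs_card_hits_le C B hl hKl h1 h2) hq.le
  · rw [← Finset.expect_div, ← Finset.mul_expect, expect_card_hits, div_pow]
    refine div_le_div_of_nonneg_right ?_ (by positivity)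
    rw [sq]
    exact mul_le_mul_of_nonneg_left h1 (by positivity)

end BlockAverage

/-- Hybrid argument: exchange one coordinate at a time, freezing the others inside the test
function. -/
theorem expect_pi_le {Ω Ω' D : Type} [Fintype Ω] [Fintype Ω'] [Nonempty Ω] [Nonempty Ω']
    (f : Ω → D) (f' : Ω' → D) {δ : ℝ}
    (h : ∀ Ψ : D → ℝ, (∀ d, 0 ≤ Ψ d) → (∀ d, Ψ d ≤ 1) →
      (𝔼 ω, Ψ (f ω)) ≤ (𝔼 ω', Ψ (f' ω')) + δ) (n : ℕ) (Φ : (Fin n → D) → ℝ)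
    (h0 : ∀ d, 0 ≤ Φ d) (h1 : ∀ d, Φ d ≤ 1) :
    (𝔼 ω : Fin n → Ω, Φ fun k => f (ω k)) ≤ (𝔼 ω' : Fin n → Ω', Φ fun k => f' (ω' k)) + n * δ := by
  induction n with
  | zero =>
    have hc : ∀ d d' : Fin 0 → D, Φ d = Φ d' := fun d d' => congrArg Φ (Subsingleton.elim _ _)
    have e1 : ∀ ω : Fin 0 → Ω, (Φ fun k => f (ω k)) = Φ Fin.elim0 := fun ω => hc _ _
    have e2 : ∀ ω : Fin 0 → Ω', (Φ fun k => f' (ω k)) = Φ Fin.elim0 := fun ω => hc _ _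
    simp only [e1, e2, Fintype.expect_const]
    simp
  | succ n ih =>
    have hcons : ∀ {A : Type} (f : A → D) (a : A) (s : Fin n → A),
        (fun k => f ((Fin.cons a s : Fin (n + 1) → A) k)) = Fin.cons (f a) fun k => f (s k) := by
      intro A f a s
      ext k
      refine Fin.cases ?_ (fun k => ?_) k <;> simp
    rw [expect_fin_succ, expect_fin_succ]
    simp only [hcons]
    refine (Finset.expect_le_expect fun a _ => ih (fun d => Φ (Fin.cons (f a) d))
      (fun d => h0 _) (fun d => h1 _)).trans ?_
    rw [Finset.expect_add_distrib, Fintype.expect_const, Finset.expect_comm]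
    refine (add_le_add (Finset.expect_le_expect fun s _ => h (fun d => Φ (Fin.cons d _))
      (fun d => h0 _) (fun d => h1 _)) le_rfl).trans ?_
    rw [Finset.expect_add_distrib, Fintype.expect_const, Finset.expect_comm]
    push_cast
    linarith

/-! ### Ordered shattering -/

section Shattering

variable {α : Type}

/-- Ordered shattering with width `q`: the set contains the leaves of a tree whose nodes have `q`
children on the levels selected by the pattern, and one child on the other levels. -/
def Shatters (q : ℕ) : {n : ℕ} → (Fin n → Bool) → Set (Fin n → α) → Prop
  | 0, _, S => S.Nonempty
  | _ + 1, b, S =>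
    (b 0 = true ∧ ∃ D : Finset α, D.card = q ∧
      ∀ x ∈ D, Shatters q (Fin.tail b) {s | (Fin.cons x s : Fin _ → α) ∈ S}) ∨
    (b 0 = false ∧ ∃ x, Shatters q (Fin.tail b) {s | (Fin.cons x s : Fin _ → α) ∈ S})

theorem sum_fin_succ {A M : Type*} [Fintype A] [AddCommMonoid M] {n : ℕ}
    (F : (Fin (n + 1) → A) → M) : ∑ f, F f = ∑ a, ∑ s : Fin n → A, F (Fin.cons a s) := by
  rw [← Fintype.sum_prod_type']
  symm
  exact Fintype.sum_equiv (Fin.consEquiv fun _ => A) _ _ fun _ => rfl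

open Classical in
-- A Sauer–Shelah count by induction on the first coordinate. For a tail pattern, let `A` be the
-- values whose section shatters it: if `|A| ≥ q` the first level can branch, otherwise fewer than
-- `q` values are charged to a level that does not.
theorem card_le_sum_shatters [Fintype α] (q : ℕ) {n : ℕ} (S : Finset (Fin n → α)) :
    S.card ≤ ∑ b : Fin n → Bool,
      if Shatters q b (S : Set (Fin n → α)) then ∏ i, (if b i then Fintype.card α else q) else 0 := by
  induction n with
  | zero =>
    have h1 : S.card ≤ 1 := Finset.card_le_one.mpr fun a _ b _ => Subsingleton.elim a b
    rcases S.eq_empty_or_nonempty with rfl | hS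
    · simp
    · simpa [Shatters, hS] using h1
  | succ n ih =>
    set T : α → Finset (Fin n → α) := fun x => Finset.univ.filter fun s => Fin.cons x s ∈ S with hT
    have hcard : S.card = ∑ x, (T x).card := by
      have h1 : S.card = ∑ f : Fin (n + 1) → α, if f ∈ S then 1 else 0 := by simp
      rw [h1, sum_fin_succ]
      refine Finset.sum_congr rfl fun x _ => ?_
      rw [hT, Finset.card_filter]
    have hset : ∀ x, {s : Fin n → α | (Fin.cons x s : Fin (n + 1) → α) ∈ (S : Set (Fin (n + 1) → α))}
        = (T x : Set (Fin n → α)) := by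
      intro x
      ext s
      simp [hT]
    rw [hcard, sum_fin_succ, Fintype.sum_bool, ← Finset.sum_add_distrib]
    refine (Finset.sum_le_sum fun x _ => ih (T x)).trans ?_
    rw [Finset.sum_comm]
    refine Finset.sum_le_sum fun b _ => ?_
    simp only [Shatters, Fin.cons_zero, Fin.tail_cons, hset, Fin.prod_univ_succ, Fin.cons_succ]
    set w := ∏ i, (if b i then Fintype.card α else q)
    set A := Finset.univ.filter fun x => Shatters q b (T x : Set (Fin n → α)) with hA
    rw [← Finset.sum_filter, Finset.sum_const, smul_eq_mul]
    change A.card * w ≤ _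
    have hAt : A.card ≤ Fintype.card α := Finset.card_le_univ A
    by_cases hq : q ≤ A.card
    · obtain ⟨D, hD, hDq⟩ := Finset.exists_subset_card_eq hq
      have : ∃ D : Finset α, D.card = q ∧ ∀ x ∈ D, Shatters q b (T x : Set (Fin n → α)) :=
        ⟨D, hDq, fun x hx => (Finset.mem_filter.mp (hD hx)).2⟩
      simp only [this, true_and, if_true, Bool.true_eq_false, false_and, or_false]
      exact (Nat.mul_le_mul_right w hAt).trans (Nat.le_add_right _ _)
    · rcases A.eq_empty_or_nonempty with hA0 | ⟨x, hx⟩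
      · simp [hA0]
      · have : ∃ x, Shatters q b (T x : Set (Fin n → α)) := ⟨x, (Finset.mem_filter.mp hx).2⟩
        simp only [this, true_and, or_true, if_true, Bool.false_eq_true, if_false]
        exact (Nat.mul_le_mul_right w (by omega)).trans (Nat.le_add_left _ _)

/-- There are `2 ^ n` patterns, and those with fewer than `N` branching levels weigh at most `|α| ^
N * q ^ (n - N)` each. -/
theorem exists_shatters [Fintype α] {q n N : ℕ} (hN : N ≤ n) (hq : q ≤ Fintype.card α)
    (S : Finset (Fin n → α)) (hS : 2 ^ n * (Fintype.card α ^ N * q ^ (n - N)) < S.card) :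
    ∃ b : Fin n → Bool, N ≤ (Finset.univ.filter fun i => b i = true).card ∧
      Shatters q b (S : Set (Fin n → α)) := by
  classical
  by_contra! H
  refine absurd (card_le_sum_shatters q S) (not_le.mpr (lt_of_le_of_lt ?_ hS))
  have : ∀ b : Fin n → Bool, (if Shatters q b (S : Set (Fin n → α)) then
      ∏ i, (if b i then Fintype.card α else q) else 0) ≤ Fintype.card α ^ N * q ^ (n - N) := by
    intro b
    split_ifs with h
    · set m := (Finset.univ.filter fun i => b i = true).card with hm
      have hmN : m < N := by
        by_contra! h'
        exact H b h' h
      rw [Finset.prod_ite, Finset.prod_const, Finset.prod_const, ← hm]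
      have h2 : (Finset.univ.filter fun i => ¬ b i = true).card = (N - m) + (n - N) := by
        have := Finset.card_filter_add_card_filter_not (s := (Finset.univ : Finset (Fin n)))
          (fun i => b i = true)
        rw [← hm, Finset.card_univ, Fintype.card_fin] at this
        omega
      rw [h2, pow_add, ← mul_assoc]
      refine Nat.mul_le_mul_right _ ?_
      calc Fintype.card α ^ m * q ^ (N - m) ≤ Fintype.card α ^ m * Fintype.card α ^ (N - m) :=
            Nat.mul_le_mul_left _ (Nat.pow_le_pow_left hq _)
        _ = Fintype.card α ^ N := by rw [← pow_add]; congr 1; omega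
    · exact Nat.zero_le _
  refine (Finset.sum_le_sum fun b _ => this b).trans ?_
  simp

theorem exists_perm_mem_iff [Fintype α] {C D : Finset α} (h : D.card = C.card) :
    ∃ π : Equiv.Perm α, ∀ x ∈ C, π x ∈ D := by
  classical
  refine ⟨(Finset.equivOfCardEq h.symm).extendSubtype, fun x hx => ?_⟩
  exact Equiv.extendSubtype_mem _ x hx

/-- A shattered set contains the image of a power of `C` under a map that on the selected levels
acts by permutations, each of which is determined by the earlier coordinates. -/
theorem Shatters.exists_map [Fintype α] {C : Finset α} {n : ℕ} {b : Fin n → Bool}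
    {S : Set (Fin n → α)} (h : Shatters C.card b S) :
    ∃ (X : (Fin n → α) → Fin n → α) (θ : (Fin n → α) → Fin n → Equiv.Perm α),
      (∀ s, (∀ i, s i ∈ C) → X s ∈ S) ∧
      (∀ s, (∀ i, s i ∈ C) → ∀ i, b i = true → X s i = θ s i (s i)) ∧
      ∀ s s' i, (∀ j < i, s j = s' j) → θ s i = θ s' i := by
  induction n with
  | zero =>
    obtain ⟨x, hx⟩ := h
    refine ⟨fun _ => x, fun _ _ => 1, fun _ _ => hx, fun _ _ i => i.elim0, fun _ _ i => i.elim0⟩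
  | succ n ih =>
    rcases h with ⟨hb, D, hD, h⟩ | ⟨hb, x, h⟩
    · have hch : ∀ x : α, ∃ (X : (Fin n → α) → Fin n → α) (θ : (Fin n → α) → Fin n → Equiv.Perm α),
          (x ∈ D → ∀ s, (∀ i, s i ∈ C) → (Fin.cons x (X s) : Fin (n + 1) → α) ∈ S) ∧
          (x ∈ D → ∀ s, (∀ i, s i ∈ C) → ∀ i, Fin.tail b i = true → X s i = θ s i (s i)) ∧
          ∀ s s' i, (∀ j < i, s j = s' j) → θ s i = θ s' i := by
        intro x
        by_cases hx : x ∈ D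
        · obtain ⟨X, θ, h1, h2, h3⟩ := ih (h x hx)
          exact ⟨X, θ, fun _ => h1, fun _ => h2, h3⟩
        · exact ⟨id, fun _ _ => 1, fun h' => absurd h' hx, fun h' => absurd h' hx,
            fun _ _ _ _ => rfl⟩
      choose X θ h1 h2 h3 using hch
      -- A permutation carries `C` into the set of children; the subtree entered, and with it every
      -- later permutation, depends on `π (s 0)`.
      obtain ⟨π, hπ⟩ := exists_perm_mem_iff hD
      refine ⟨fun s => Fin.cons (π (s 0)) (X (π (s 0)) (Fin.tail s)),
        fun s => Fin.cons π (θ (π (s 0)) (Fin.tail s)), ?_, ?_, ?_⟩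
      · intro s hs
        exact h1 _ (hπ _ (hs 0)) _ fun i => hs i.succ
      · intro s hs i
        refine Fin.cases ?_ (fun i => ?_) i
        · intro _
          simp
        · intro hi
          simpa [Fin.tail] using h2 _ (hπ _ (hs 0)) (Fin.tail s) (fun i => hs i.succ) i hi
      · intro s s' i
        refine Fin.cases ?_ (fun i => ?_) i
        · intro _
          simp
        · intro hj
          have h0 : s 0 = s' 0 := hj 0 (Fin.succ_pos i)
          simp only [Fin.cons_succ, h0]
          exact h3 _ _ _ i fun j hji => hj j.succ (Fin.succ_lt_succ_iff.mpr hji)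
    · obtain ⟨X, θ, h1, h2, h3⟩ := ih h
      refine ⟨fun s => Fin.cons x (X (Fin.tail s)), fun s => Fin.cons 1 (θ (Fin.tail s)), ?_, ?_, ?_⟩
      · intro s hs
        exact h1 _ fun i => hs i.succ
      · intro s hs i
        refine Fin.cases ?_ (fun i => ?_) i
        · intro h'
          simp [hb] at h'
        · intro hi
          simpa [Fin.tail] using h2 (Fin.tail s) (fun i => hs i.succ) i hi
      · intro s s' i
        refine Fin.cases ?_ (fun i => ?_) i
        · intro _
          simp
        · intro hj
          simp only [Fin.cons_succ]
          exact h3 _ _ i fun j hji => hj j.succ (Fin.succ_lt_succ_iff.mpr hji)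

/-- The same with the selected levels arranged in `n'` blocks of `B` levels. -/
theorem Shatters.exists_blocks [Fintype α] {C : Finset α} (hC : C.Nonempty) {n n' B : ℕ}
    {b : Fin n → Bool} {S : Set (Fin n → α)} (h : Shatters C.card b S)
    (hb : n' * B ≤ (Finset.univ.filter fun i => b i = true).card) :
    ∃ (pos : Fin n' × Fin B → Fin n) (X : (Fin n' × Fin B → α) → Fin n → α)
      (θ : (Fin n' × Fin B → α) → Fin n' × Fin B → Equiv.Perm α),
      Function.Injective pos ∧ (∀ k i j, i < j → pos (k, i) < pos (k, j)) ∧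
      (∀ s, (∀ i, s i ∈ C) → X s ∈ S) ∧
      (∀ s, (∀ i, s i ∈ C) → ∀ i, X s (pos i) = θ s i (s i)) ∧
      ∀ s s' i, (∀ j, pos j < pos i → s j = s' j) → θ s i = θ s' i := by
  classical
  obtain ⟨c, hc⟩ := hC
  obtain ⟨X, θ, h1, h2, h3⟩ := h.exists_map
  set e := Finset.orderEmbOfCardLe _ hb
  set pos : Fin n' × Fin B → Fin n := fun i => e (finProdFinEquiv i) with hpos
  have hinj : Function.Injective pos := fun i j hij =>
    finProdFinEquiv.injective (e.injective hij)
  -- Levels outside the blocks receive a constant of `C`, so dependence on earlier coordinates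
  -- reduces to earlier block positions.
  have hext : ∀ (s : Fin n' × Fin B → α), (∀ i, s i ∈ C) →
      ∀ i, Function.extend pos s (fun _ => c) i ∈ C := by
    intro s hs i
    by_cases hi : ∃ j, pos j = i
    · obtain ⟨j, rfl⟩ := hi
      rw [hinj.extend_apply]
      exact hs j
    · rw [Function.extend_apply' _ _ _ hi]
      exact hc
  refine ⟨pos, fun s => X (Function.extend pos s fun _ => c),
    fun s i => θ (Function.extend pos s fun _ => c) (pos i), hinj, ?_, ?_, ?_, ?_⟩
  · intro k i j hij
    refine e.strictMono (Fin.lt_def.mpr ?_)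
    simp only [finProdFinEquiv_apply_val]
    exact Nat.add_lt_add_right hij _
  · intro s hs
    exact h1 _ (hext s hs)
  · intro s hs i
    have hbi : b (pos i) = true := by
      have := Finset.orderEmbOfCardLe_mem _ hb (finProdFinEquiv i)
      simpa using this
    beta_reduce
    rw [h2 _ (hext s hs) _ hbi, hinj.extend_apply]
  · intro s s' i hj
    refine h3 _ _ _ fun l hl => ?_
    by_cases hl' : ∃ j, pos j = l
    · obtain ⟨j, rfl⟩ := hl'
      rw [hinj.extend_apply, hinj.extend_apply, hj j hl]
    · rw [Function.extend_apply' _ _ _ hl', Function.extend_apply' _ _ _ hl']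

end Shattering

/-! ### Embedding a smaller game into a shattered set -/

section Embedding

set_option linter.unusedSectionVars false

theorem expect_arrow_prod {A A' : Type} [Fintype A] [Fintype A'] {n : ℕ}
    (F : (Fin n → A × A') → ℝ) :
    (𝔼 ω, F ω) = 𝔼 a : Fin n → A, 𝔼 a' : Fin n → A', F fun k => (a k, a' k) := by
  rw [← Finset.expect_product' Finset.univ Finset.univ fun (a : Fin n → A) (a' : Fin n → A') =>
    F fun k => (a k, a' k)]
  exact Fintype.expect_equiv (Equiv.arrowProdEquivProdArrow (Fin n) (fun _ => A) fun _ => A') _ _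
    fun _ => rfl

variable {α : Type} [Fintype α] [DecidableEq α] [Nonempty α]

theorem expect_extend {I : Type} [Fintype I] [DecidableEq I] {n : ℕ} {pos : I → Fin n}
    (hpos : Function.Injective pos) (W : (Fin n → α) → ℝ) :
    (𝔼 r : I → α, 𝔼 z : Fin n → α, W (Function.extend pos r z)) = 𝔼 y, W y := by
  classical
  rw [← Finset.expect_product' Finset.univ Finset.univ fun (r : I → α) (z : Fin n → α) =>
    W (Function.extend pos r z)]
  refine expect_eq_expect_comp _ Finset.univ
    (fun rz : (I → α) × (Fin n → α) => Function.extend pos rz.1 rz.2)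
    (fun _ _ => Finset.mem_univ _) ?_ ⟨(fun _ => Classical.arbitrary α,
      fun _ => Classical.arbitrary α), by simp⟩ W
  intro y _ y' _
  set φ : (I → α) × (Fin n → α) → (I → α) × (Fin n → α) := fun rz =>
    (fun i => Equiv.swap (y (pos i)) (y' (pos i)) (rz.1 i),
      fun j => Equiv.swap (y j) (y' j) (rz.2 j)) with hφ
  have hext : ∀ rz, Function.extend pos (φ rz).1 (φ rz).2 =
      fun j => Equiv.swap (y j) (y' j) (Function.extend pos rz.1 rz.2 j) := by
    intro rz
    ext j
    by_cases hj : ∃ i, pos i = j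
    · obtain ⟨i, rfl⟩ := hj
      rw [hpos.extend_apply, hpos.extend_apply]
    · rw [Function.extend_apply' _ _ _ hj, Function.extend_apply' _ _ _ hj]
  have hinv : ∀ rz, φ (φ rz) = rz := by
    intro rz
    simp [hφ]
  refine Finset.card_bij' (fun rz _ => φ rz) (fun rz _ => φ rz) ?_ ?_ (fun rz _ => hinv rz)
    (fun rz _ => hinv rz)
  · intro rz h
    have h' := (Finset.mem_filter.mp h).2
    refine Finset.mem_filter.mpr ⟨by simp, ?_⟩
    rw [hext, h']
    ext j
    simp
  · intro rz h
    have h' := (Finset.mem_filter.mp h).2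
    refine Finset.mem_filter.mpr ⟨by simp, ?_⟩
    rw [hext, h']
    ext j
    simp

theorem expect_apply {I : Type} [Fintype I] [DecidableEq I] (i : I) (W : α → ℝ) :
    (𝔼 y : I → α, W (y i)) = 𝔼 a, W a := by
  refine expect_eq_expect_comp Finset.univ Finset.univ (fun y : I → α => y i)
    (fun _ _ => Finset.mem_univ _) ?_ ⟨fun _ => Classical.arbitrary α, by simp⟩ W
  intro c _ c' _
  refine Finset.card_bij' (fun y _ => fun j => Equiv.swap c c' (y j))
    (fun y _ => fun j => Equiv.swap c c' (y j)) ?_ ?_ ?_ ?_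
  · intro y h
    have h' := (Finset.mem_filter.mp h).2
    exact Finset.mem_filter.mpr ⟨by simp, by simp [h']⟩
  · intro y h
    have h' := (Finset.mem_filter.mp h).2
    exact Finset.mem_filter.mpr ⟨by simp, by simp [h']⟩
  · intro y _
    simp
  · intro y _
    simp

theorem expect_exists_agree_le {I : Type} [Fintype I] [DecidableEq I] (J : Finset I) (x : I → α) :
    (𝔼 y : I → α, if ∃ j ∈ J, x j = y j then (1 : ℝ) else 0) ≤ J.card / Fintype.card α := by
  have hpt : ∀ y : I → α, (if ∃ j ∈ J, x j = y j then (1 : ℝ) else 0) ≤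
      ∑ j ∈ J, if x j = y j then (1 : ℝ) else 0 := by
    intro y
    have h0 : ∀ j ∈ J, (0 : ℝ) ≤ if x j = y j then (1 : ℝ) else 0 := by
      intro j _
      split_ifs <;> norm_num
    split_ifs with h
    · obtain ⟨j, hj, hxy⟩ := h
      refine le_trans ?_ (Finset.single_le_sum h0 hj)
      simp [hxy]
    · exact Finset.sum_nonneg h0
  refine (Finset.expect_le_expect fun y _ => hpt y).trans (le_of_eq ?_)
  rw [Finset.expect_sum_comm]
  have : ∀ j ∈ J, (𝔼 y : I → α, if x j = y j then (1 : ℝ) else 0) = 1 / Fintype.card α := by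
    intro j _
    rw [expect_apply j fun a => if x j = a then (1 : ℝ) else 0, Fintype.expect_eq_sum_div_card]
    simp
  rw [Finset.sum_congr rfl this]
  simp [div_eq_mul_inv]

variable {γ : Type} [Fintype γ] [DecidableEq γ] [Nonempty γ]

/-- The vectors of the blocks, arranged as one vector. -/
noncomputable def blockVecs (ι : γ → α) (C : Finset α) {n' B K : ℕ} (u : Fin n' → γ)
    (κ : Fin n' → Fin K) (g : Fin n' → Fin B → Equiv.Perm α) (i : Fin n' × Fin B) : α :=
  blockVec ι C (u i.1) (κ i.1) (g i.1) i.2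

/-- The factor at a position depends on `g` only at strictly earlier positions, so `g` is recovered
position by position. -/
theorem twist_bijective (ι : γ → α) (C : Finset α) {n n' B K : ℕ} {pos : Fin n' × Fin B → Fin n}
    (hpos : ∀ k i j, i < j → pos (k, i) < pos (k, j))
    {θ : (Fin n' × Fin B → α) → Fin n' × Fin B → Equiv.Perm α}
    (hθ : ∀ s s' i, (∀ j, pos j < pos i → s j = s' j) → θ s i = θ s' i)
    (u : Fin n' → γ) (κ : Fin n' → Fin K) :
    Function.Bijective fun (g : Fin n' → Fin B → Equiv.Perm α) (k : Fin n') (i : Fin B) =>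
      θ (blockVecs ι C u κ g) (k, i) * g k i := by
  rw [← Finite.injective_iff_bijective]
  intro g g' h
  have key : ∀ m : ℕ, ∀ i : Fin n' × Fin B, (pos i : ℕ) < m → g i.1 i.2 = g' i.1 i.2 := by
    intro m
    induction m with
    | zero => intro i hi; omega
    | succ m ih =>
      intro i hi
      have h1 : θ (blockVecs ι C u κ g) i = θ (blockVecs ι C u κ g') i := by
        refine hθ _ _ _ fun j hj => ?_
        refine blockVec_congr (fun l hl => ?_) _ _
        refine ih (j.1, l) ?_
        have h2 : pos (j.1, l) ≤ pos j := by
          rcases hl.lt_or_eq with h3 | h3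
          · exact (hpos j.1 l j.2 h3).le
          · rw [h3]
        have h3 : (pos (j.1, l) : ℕ) ≤ pos j := h2
        have h4 : (pos j : ℕ) < pos i := hj
        omega
      have h2 := congrFun (congrFun h i.1) i.2
      simp only [h1] at h2
      exact mul_left_cancel h2
  ext k i : 2
  exact key _ (k, i) (Nat.lt_succ_self _)

/-- Bob encodes with the public `g` itself; Alice, who knows her labels and ranks, inverts the twist
first. In the untwisted variables both entries at a block position carry the same permutation `θ`,
which preserves agreement. The errors are that on `S`, accidental agreement outside the blocks, and
the block comparison taken `n'` times. -/
theorem exists_embedding {ι : γ → α} (hι : Function.Injective ι) {C : Finset α}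
    (hC : Fintype.card γ < C.card) {K B : ℕ} (hK : C.card = K * Fintype.card γ)
    {l η : ℝ} (hl : 0 < l) (hKl : (K : ℝ) = l ^ 2)
    (h1 : B * (C.card / Fintype.card α : ℝ) ≤ K)
    (h2 : K * (1 - η) ≤ B * (C.card / Fintype.card α : ℝ))
    {n n' : ℕ} {b : Fin n → Bool} {S : Set (Fin n → α)} (hS : Shatters C.card b S)
    (hb : n' * B ≤ (Finset.univ.filter fun i => b i = true).card)
    (p : (Fin n → α) → (Fin n → α) → Bool) {ε : ℝ}
    (hε : ∀ x ∈ S, (𝔼 y, if p x y ≠ decide (∃ i, x i = y i) then (1 : ℝ) else 0) ≤ ε) :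
    ∃ f h : (Fin n' → γ) → Fin n → α,
      (𝔼 u, 𝔼 v, if p (f u) (h v) ≠ decide (∃ i, u i = v i) then (1 : ℝ) else 0) ≤
        ε + ((n - n' * B : ℕ) : ℝ) / Fintype.card α +
          n' * ((l + K * η) / C.card + (K / C.card : ℝ) ^ 2) := by
  classical
  have hC0 : 0 < C.card := by omega
  have hK0 : 0 < K := by
    rcases Nat.eq_zero_or_pos K with h | h
    · rw [h] at hK; omega
    · exact h
  have : Nonempty (Fin K) := ⟨⟨0, hK0⟩⟩
  have : Nonempty C := (Finset.card_pos.mp hC0).to_subtype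
  obtain ⟨pos, X, θ, hinj, hmono, hX, hXθ, hθ⟩ := hS.exists_blocks (Finset.card_pos.mp hC0) hb
  set δ : ℝ := (l + K * η) / C.card + (K / C.card : ℝ) ^ 2 with hδ
  set T : (u : Fin n' → γ) → (κ : Fin n' → Fin K) → (Fin n' → Fin B → Equiv.Perm α) ≃
      (Fin n' → Fin B → Equiv.Perm α) := fun u κ =>
    Equiv.ofBijective _ (twist_bijective ι C hmono hθ u κ) with hT
  set Φ : (Fin n → α) → (Fin n' → (Fin B → α) × (Fin B → α) × Bool) → ℝ := fun z d =>
    if p (X fun i => (d i.1).1 i.2)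
        (Function.extend pos (fun i => θ (fun i => (d i.1).1 i.2) i ((d i.1).2.1 i.2)) z) ≠
      decide (∃ k, (d k).2.2 = true) then 1 else 0 with hΦ
  set A : (Fin n' → Fin K) → (Fin n' → Fin B → Equiv.Perm α) → (Fin n' → γ) → Fin n → α :=
    fun κ g u => X (blockVecs ι C u κ ((T u κ).symm g)) with hA
  set Bo : (Fin n → α) → (Fin n' → Fin B → Equiv.Perm α) → (Fin n' → γ) → Fin n → α :=
    fun z g v => Function.extend pos (fun i => g i.1 i.2 (ι (v i.1))) z with hBo
  set L : (Fin n → α) → (Fin n' → Fin K) → (Fin n' → Fin B → Equiv.Perm α) → (Fin n' → γ) →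
      (Fin n' → γ) → ℝ := fun z κ g u v =>
    if p (A κ g u) (Bo z g v) ≠ decide (∃ i, u i = v i) then 1 else 0 with hL
  -- For fixed labels and ranks the twist permutes the choices of `g`, so averaging over `g` may use
  -- the untwisted variables.
  have hLΦ : ∀ z κ u v, (𝔼 g, L z κ g u v) =
      𝔼 g : Fin n' → Fin B → Equiv.Perm α,
        Φ z fun k => blockOutcome ι C ((u k, v k), (κ k, g k)) := by
    intro z κ u v
    symm
    refine Fintype.expect_equiv (T u κ) _ _ fun g => ?_
    simp only [hL, hΦ, hA, hBo, Equiv.symm_apply_apply, blockOutcome, decide_eq_true_eq]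
    rfl
  have hΦ0 : ∀ z d, 0 ≤ Φ z d := by
    intro z d
    simp only [hΦ]
    split_ifs <;> norm_num
  have hΦ1 : ∀ z d, Φ z d ≤ 1 := by
    intro z d
    simp only [hΦ]
    split_ifs <;> norm_num
  have hpi : ∀ z, (𝔼 ω : Fin n' → (γ × γ) × (Fin K × (Fin B → Equiv.Perm α)),
        Φ z fun k => blockOutcome ι C (ω k)) ≤
      (𝔼 ω : Fin n' → (Fin B → C) × (Fin B → α), Φ z fun k => matchOutcome (ω k)) + n' * δ :=
    fun z => expect_pi_le _ _ (fun Ψ h0 h1' =>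
      blockOutcome_average_le hι hC hK hl hKl h1 h2 Ψ h0 h1') n' (Φ z) (hΦ0 z) (hΦ1 z)
  have hleft : (𝔼 z, 𝔼 κ, 𝔼 g, 𝔼 u, 𝔼 v, L z κ g u v) =
      𝔼 z, 𝔼 ω : Fin n' → (γ × γ) × (Fin K × (Fin B → Equiv.Perm α)),
        Φ z fun k => blockOutcome ι C (ω k) := by
    refine Finset.expect_congr rfl fun z _ => ?_
    have e1 : (𝔼 ω : Fin n' → (γ × γ) × (Fin K × (Fin B → Equiv.Perm α)),
        Φ z fun k => blockOutcome ι C (ω k)) = 𝔼 u, 𝔼 v, 𝔼 κ, 𝔼 g, L z κ g u v := by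
      rw [expect_arrow_prod, expect_arrow_prod]
      refine Finset.expect_congr rfl fun u _ => Finset.expect_congr rfl fun v _ => ?_
      rw [expect_arrow_prod]
      exact Finset.expect_congr rfl fun κ _ => (hLΦ z κ u v).symm
    rw [e1]
    have e2 : ∀ κ, (𝔼 g, 𝔼 u, 𝔼 v, L z κ g u v) = 𝔼 u, 𝔼 v, 𝔼 g, L z κ g u v := by
      intro κ
      rw [Finset.expect_comm]
      exact Finset.expect_congr rfl fun u _ => Finset.expect_comm _ _ _
    simp only [e2]
    rw [Finset.expect_comm]
    exact Finset.expect_congr rfl fun u _ => Finset.expect_comm _ _ _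
  -- For fixed `s` Alice's input is one point of `S`, so `θ` is fixed and Bob's input stays uniform;
  -- the error hypothesis on `S` applies.
  have hright : ∀ s : Fin n' → Fin B → C, (𝔼 r : Fin n' → Fin B → α, 𝔼 z,
      Φ z fun k => matchOutcome (s k, r k)) ≤ ε + ((n - n' * B : ℕ) : ℝ) / Fintype.card α := by
    intro s
    set s' : Fin n' × Fin B → α := fun i => s i.1 i.2 with hs'
    have hs'C : ∀ i, s' i ∈ C := fun i => (s i.1 i.2).2
    set W : (Fin n → α) → ℝ := fun y =>
      if p (X s') y ≠ decide (∃ i, X s' (pos i) = y (pos i)) then 1 else 0 with hW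
    have e1 : (𝔼 r : Fin n' → Fin B → α, 𝔼 z, Φ z fun k => matchOutcome (s k, r k)) =
        𝔼 r : Fin n' × Fin B → α, 𝔼 z, W (Function.extend pos r z) := by
      refine Fintype.expect_equiv ((Equiv.curry (Fin n') (Fin B) α).symm.trans
        (Equiv.piCongrRight (θ s'))) _ _ fun r => ?_
      refine Finset.expect_congr rfl fun z _ => ?_
      have e2 : (∃ k, (matchOutcome (s k, r k)).2.2 = true) ↔
          ∃ i, X s' (pos i) = Function.extend pos ((Equiv.piCongrRight (θ s'))
            ((Equiv.curry (Fin n') (Fin B) α).symm r)) z (pos i) := by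
        simp only [hinj.extend_apply, hXθ s' hs'C, matchOutcome, decide_eq_true_eq]
        constructor
        · rintro ⟨k, i, hki⟩
          exact ⟨(k, i), congrArg (θ s' (k, i)) hki⟩
        · rintro ⟨⟨k, i⟩, hki⟩
          exact ⟨k, i, (θ s' (k, i)).injective hki⟩
      simp only [hΦ, hW, Equiv.trans_apply, ← e2]
      rfl
    rw [e1, expect_extend hinj]
    set J : Finset (Fin n) := Finset.univ \ Finset.univ.image pos with hJ
    have hJc : J.card = n - n' * B := by
      rw [hJ, Finset.card_sdiff_of_subset (Finset.subset_univ _),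
        Finset.card_image_of_injective _ hinj]
      simp
    have hWle : ∀ y, W y ≤ (if p (X s') y ≠ decide (∃ i, X s' i = y i) then (1 : ℝ) else 0) +
        if ∃ j ∈ J, X s' j = y j then (1 : ℝ) else 0 := by
      intro y
      by_cases hj : ∃ j ∈ J, X s' j = y j
      · rw [if_pos hj]
        have : W y ≤ 1 := by
          simp only [hW]
          split_ifs <;> norm_num
        have h0 : (0 : ℝ) ≤ if p (X s') y ≠ decide (∃ i, X s' i = y i) then (1 : ℝ) else 0 := by
          split_ifs <;> norm_num
        linarith
      · have : (∃ i, X s' (pos i) = y (pos i)) ↔ ∃ i, X s' i = y i := by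
          constructor
          · rintro ⟨i, hi⟩
            exact ⟨_, hi⟩
          · rintro ⟨i, hi⟩
            by_cases hir : i ∈ Finset.univ.image pos
            · obtain ⟨i', _, rfl⟩ := Finset.mem_image.mp hir
              exact ⟨i', hi⟩
            · exact absurd ⟨i, by simpa [hJ] using hir, hi⟩ hj
        rw [if_neg hj, add_zero]
        simp only [hW, this]
        exact le_rfl
    refine (Finset.expect_le_expect fun y _ => hWle y).trans ?_
    rw [Finset.expect_add_distrib]
    refine add_le_add (hε _ (hX s' hs'C)) ?_
    rw [← hJc]
    refine le_trans (le_of_eq ?_) (expect_exists_agree_le J (X s'))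
    refine Finset.expect_congr rfl fun y _ => ?_
    congr
  have htotal : (𝔼 z, 𝔼 κ, 𝔼 g, 𝔼 u, 𝔼 v, L z κ g u v) ≤
      ε + ((n - n' * B : ℕ) : ℝ) / Fintype.card α + n' * δ := by
    rw [hleft]
    refine (Finset.expect_le_expect fun z _ => hpi z).trans ?_
    rw [Finset.expect_add_distrib, Fintype.expect_const]
    refine add_le_add ?_ le_rfl
    have e1 : (𝔼 z, 𝔼 ω : Fin n' → (Fin B → C) × (Fin B → α), Φ z fun k => matchOutcome (ω k)) =
        𝔼 s : Fin n' → Fin B → C, 𝔼 r : Fin n' → Fin B → α, 𝔼 z,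
          Φ z fun k => matchOutcome (s k, r k) := by
      rw [Finset.expect_comm, expect_arrow_prod]
    rw [e1]
    exact Finset.expect_le Finset.univ_nonempty fun s _ => hright s
  obtain ⟨z, _, hz⟩ := Finset.exists_le_of_expect_le Finset.univ_nonempty htotal
  obtain ⟨κ, _, hκ⟩ := Finset.exists_le_of_expect_le Finset.univ_nonempty hz
  obtain ⟨g, _, hg⟩ := Finset.exists_le_of_expect_le Finset.univ_nonempty hκ
  exact ⟨A κ g, Bo z g, hg⟩

end Embedding

/-! ### Eliminating a round -/

/-- The protocol in which the players first translate their inputs. -/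
def DetProtocol.comap {X Y : Type} {c : ℕ} : {r : ℕ} → (Y → X) → (Y → X) →
    DetProtocol X c r → DetProtocol Y c r
  | _, f, _, .output g => .output (g ∘ f)
  | _, f, h, .speak msg next => .speak (msg ∘ f) fun w => (next w).comap h f

theorem DetProtocol.run_comap {X Y : Type} {c r : ℕ} (P : DetProtocol X c r) (f h : Y → X)
    (a b : Y) : (P.comap f h).run a b = P.run (f a) (h b) := by
  induction P generalizing f h a b with
  | output g => rfl
  | speak msg next ih => exact ih _ _ _ _ _

/-- The error of an output function for exists-equal on uniformly distributed inputs. -/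
noncomputable def averageError {t n : ℕ} (p : (Fin n → Fin t) → (Fin n → Fin t) → Bool) : ℝ :=
  𝔼 x, 𝔼 y, if p x y ≠ existsEqual t n x y then 1 else 0

theorem existsEqual_comm {t n : ℕ} (x y : Fin n → Fin t) :
    existsEqual t n x y = existsEqual t n y x := by
  unfold existsEqual
  simp only [eq_comm]

theorem expect_forall_ne {t n : ℕ} [NeZero t] (x : Fin n → Fin t) :
    (𝔼 y : Fin n → Fin t, if existsEqual t n x y = false then (1 : ℝ) else 0) =
      (1 - 1 / t) ^ n := by
  have ht : (t : ℝ) ≠ 0 := by exact_mod_cast NeZero.ne t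
  have hset : (Finset.univ.filter fun y : Fin n → Fin t => existsEqual t n x y = false) =
      Fintype.piFinset fun i => Finset.univ.erase (x i) := by
    ext y
    simp [existsEqual, eq_comm]
  rw [Fintype.expect_eq_sum_div_card, Finset.sum_boole, hset, Fintype.card_piFinset]
  simp only [Finset.card_erase_of_mem (Finset.mem_univ _), Finset.card_univ, Fintype.card_fin,
    Finset.prod_const, Fintype.card_fun, Nat.cast_pow]
  rw [← div_pow, Nat.cast_sub (NeZero.one_le), sub_div, div_self ht, Nat.cast_one]

/-- For every `x` the value is 0 with probability `(1 - 1 / t) ^ n`, which lies between 1/2 and `exp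
(-1/2) < 61/100`, so either answer errs often. -/
theorem lt_averageError_of_output {n t : ℕ} (hn : 0 < n) (htn : t = 2 * n)
    (g : (Fin n → Fin t) → Bool) :
    (39 / 100 : ℝ) < averageError fun x (_ : Fin n → Fin t) => g x := by
  have : NeZero t := ⟨by omega⟩
  have hn0 : (0 : ℝ) < n := by exact_mod_cast hn
  have ht : (t : ℝ) = 2 * n := by
    rw [htn]
    push_cast
    ring
  have ht1 : (1 : ℝ) ≤ n := by exact_mod_cast hn
  set z : ℝ := (1 - 1 / (t : ℝ)) ^ n with hz
  have hz1 : 1 / 2 ≤ z := by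
    have h1 : (-2 : ℝ) ≤ -(1 / (t : ℝ)) := by
      rw [ht]
      have : 1 / (2 * (n : ℝ)) ≤ 1 := by
        rw [div_le_one (by positivity)]
        linarith
      linarith
    have h2 := one_add_mul_le_pow h1 n
    have h3 : (1 : ℝ) + n * -(1 / (t : ℝ)) = 1 / 2 := by
      rw [ht]
      field_simp
      norm_num
    rw [h3] at h2
    simpa [hz, sub_eq_add_neg] using h2
  have hz2 : z < 61 / 100 := by
    have h1 : z ≤ Real.exp (-(1 / 2)) := by
      have h2 : 1 - 1 / (t : ℝ) ≤ Real.exp (-(1 / (2 * n))) := by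
        rw [ht]
        have := Real.add_one_le_exp (-(1 / (2 * (n : ℝ))))
        linarith
      have h3 : 0 ≤ 1 - 1 / (t : ℝ) := by
        rw [ht]
        have : 1 / (2 * (n : ℝ)) ≤ 1 := by
          rw [div_le_one (by positivity)]
          linarith
        linarith
      calc z ≤ Real.exp (-(1 / (2 * n))) ^ n := pow_le_pow_left₀ h3 h2 n
        _ = Real.exp (-(1 / 2)) := by
          rw [← Real.exp_nat_mul]
          congr 1
          field_simp
    have h4 : Real.exp (-(1 / 2)) ^ 2 = Real.exp (-1) := by
      rw [← Real.exp_nat_mul]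
      congr 1
      norm_num
    have h5 := Real.exp_neg_one_lt_d9
    have h6 : Real.exp (-(1 / 2)) < 61 / 100 := by
      refine lt_of_pow_lt_pow_left₀ 2 (by norm_num) ?_
      rw [h4]
      norm_num at h5 ⊢
      linarith
    linarith
  have hx : ∀ x : Fin n → Fin t, min z (1 - z) ≤
      𝔼 y, if g x ≠ existsEqual t n x y then (1 : ℝ) else 0 := by
    intro x
    have h1 := expect_forall_ne x
    rw [← hz] at h1
    cases hg : g x
    · have h2 : ∀ y, (if false ≠ existsEqual t n x y then (1 : ℝ) else 0) =
          1 - if existsEqual t n x y = false then (1 : ℝ) else 0 := by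
        intro y
        cases existsEqual t n x y <;> simp
      simp only [h2, Finset.expect_sub_distrib, Fintype.expect_const, h1]
      exact min_le_right _ _
    · have h2 : ∀ y, (if true ≠ existsEqual t n x y then (1 : ℝ) else 0) =
          if existsEqual t n x y = false then (1 : ℝ) else 0 := by
        intro y
        cases existsEqual t n x y <;> simp
      simp only [h2, h1]
      exact min_le_left _ _
  have hmin : (39 / 100 : ℝ) < min z (1 - z) := lt_min (by linarith) (by linarith)
  refine lt_of_lt_of_le hmin ?_
  unfold averageError
  exact Finset.le_expect Finset.univ_nonempty fun x _ => hx x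

/-- Many inputs have an error close to the average and share their message. -/
theorem exists_message_class {c : ℕ} {X : Type} [Fintype X] [Nonempty X] (msg : X → Msg c)
    (e : X → ℝ) (he : ∀ x, 0 ≤ e x) {ε : ℝ} (m : ℕ) (h : (𝔼 x, e x) ≤ ε)
    (h1 : ε + 1 / 2 ^ m ≤ 1) :
    ∃ (w : Msg c) (S : Finset X), (∀ x ∈ S, msg x = w ∧ e x ≤ ε + 1 / 2 ^ m) ∧
      Fintype.card X ≤ S.card * 2 ^ (c + 1 + m) := by
  classical
  set A := Finset.univ.filter fun x => e x ≤ ε + 1 / 2 ^ m with hA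
  have hη : (0 : ℝ) < 1 / 2 ^ m := by positivity
  have hX : (0 : ℝ) < Fintype.card X := by exact_mod_cast Fintype.card_pos
  -- Markov's inequality, where `h1` keeps the threshold at most 1.
  have hAcard : Fintype.card X ≤ A.card * 2 ^ m := by
    have hsum : ∑ x, e x ≤ ε * Fintype.card X := by
      rw [Fintype.expect_eq_sum_div_card, div_le_iff₀ hX] at h
      exact h
    have hlow : (ε + 1 / 2 ^ m) * ((Fintype.card X : ℝ) - A.card) ≤ ∑ x, e x := by
      have hc := Finset.card_filter_add_card_filter_not (s := (Finset.univ : Finset X))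
        (fun x => e x ≤ ε + 1 / 2 ^ m)
      rw [← hA, Finset.card_univ] at hc
      have hc' : (Fintype.card X : ℝ) - A.card =
          ((Finset.univ.filter fun x => ¬ e x ≤ ε + 1 / 2 ^ m).card : ℝ) := by
        rw [← hc]
        push_cast
        ring
      rw [hc']
      calc (ε + 1 / 2 ^ m) * ((Finset.univ.filter fun x => ¬ e x ≤ ε + 1 / 2 ^ m).card : ℝ)
          = ∑ x ∈ Finset.univ.filter fun x => ¬ e x ≤ ε + 1 / 2 ^ m, (ε + 1 / 2 ^ m) := by
            rw [Finset.sum_const, nsmul_eq_mul, mul_comm]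
        _ ≤ ∑ x ∈ Finset.univ.filter fun x => ¬ e x ≤ ε + 1 / 2 ^ m, e x :=
            Finset.sum_le_sum fun x hx => (not_le.mp (Finset.mem_filter.mp hx).2).le
        _ ≤ ∑ x, e x := Finset.sum_le_sum_of_subset_of_nonneg (Finset.filter_subset _ _)
            fun x _ _ => he x
    have hA0 : (0 : ℝ) ≤ A.card := by positivity
    have h2 : 1 / 2 ^ m * (Fintype.card X : ℝ) ≤ A.card := by
      nlinarith [mul_le_mul_of_nonneg_right h1 hA0]
    have h3 : (Fintype.card X : ℝ) ≤ A.card * 2 ^ m := by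
      rw [one_div, inv_mul_le_iff₀ (by positivity)] at h2
      linarith
    exact_mod_cast h3
  set code : Msg c → Σ i : Fin (c + 1), List.Vector Bool i :=
    fun w => ⟨⟨w.1.length, Nat.lt_succ_of_le w.2⟩, ⟨w.1, rfl⟩⟩ with hcode
  have hinj : Function.Injective code := by
    intro w w' hw
    have := congrArg (fun v : Σ i : Fin (c + 1), List.Vector Bool i => v.2.1) hw
    exact Subtype.ext this
  have hcardcode : Fintype.card (Σ i : Fin (c + 1), List.Vector Bool i) ≤ 2 ^ (c + 1) := by
    rw [Fintype.card_sigma]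
    simp only [card_vector, Fintype.card_bool]
    rw [← Finset.sum_range fun i => 2 ^ i, Nat.geomSum_eq le_rfl]
    simp
  have hA1 : 0 < A.card := by
    rcases Nat.eq_zero_or_pos A.card with h' | h'
    · rw [h', zero_mul] at hAcard
      exact absurd (Fintype.card_pos (α := X)) (by omega)
    · exact h'
  have hne : (Finset.univ : Finset (Σ i : Fin (c + 1), List.Vector Bool i)).Nonempty :=
    ⟨⟨0, List.Vector.nil⟩, Finset.mem_univ _⟩
  obtain ⟨v, _, hv⟩ := Finset.exists_max_image Finset.univ
    (fun v => (A.filter fun x => code (msg x) = v).card) hne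
  set S := A.filter fun x => code (msg x) = v with hS
  have hSA : A.card ≤ S.card * 2 ^ (c + 1) := by
    rw [Finset.card_eq_sum_card_fiberwise (f := fun x => code (msg x)) (t := Finset.univ)
      (fun x _ => Finset.mem_univ _)]
    refine (Finset.sum_le_card_nsmul _ _ S.card fun v' hv' => hv v' hv').trans ?_
    rw [smul_eq_mul, mul_comm]
    exact Nat.mul_le_mul_left _ hcardcode
  have hS1 : S.Nonempty := by
    rw [← Finset.card_pos]
    rcases Nat.eq_zero_or_pos S.card with h' | h'
    · rw [h', zero_mul] at hSA
      omega
    · exact h'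
  obtain ⟨x₀, hx₀⟩ := hS1
  refine ⟨msg x₀, S, fun x hx => ⟨?_, ?_⟩, ?_⟩
  · exact hinj ((Finset.mem_filter.mp hx).2.trans (Finset.mem_filter.mp hx₀).2.symm)
  · exact (Finset.mem_filter.mp (Finset.mem_filter.mp hx).1).2
  · calc Fintype.card X ≤ A.card * 2 ^ m := hAcard
      _ ≤ S.card * 2 ^ (c + 1) * 2 ^ m := Nat.mul_le_mul_right _ hSA
      _ = S.card * 2 ^ (c + 1 + m) := by rw [pow_add _ (c + 1), mul_assoc]

/-- The left side is `b + m` for the `b` of `exists_restriction_two_pow`: the new logarithm of bits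
per coordinate. -/
theorem eight_pow_bound {m : ℕ} (hm : 2 ≤ m) :
    2 ^ m * (2 ^ m + 4) + 2 * m + m ≤ 8 ^ m := by
  have h1 : m < 2 ^ m := Nat.lt_two_pow_self
  have h2 : 4 ≤ 2 ^ m := by
    calc 4 = 2 ^ 2 := rfl
      _ ≤ 2 ^ m := Nat.pow_le_pow_right (by norm_num) hm
  have h3 : 8 ^ m = 2 ^ m * 2 ^ m * 2 ^ m := by
    rw [show 8 = 2 * 2 * 2 from rfl, Nat.mul_pow, Nat.mul_pow]
  rw [h3]
  generalize 2 ^ m = a at *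
  have h4 : 4 * (a * a) ≤ a * a * a := by
    rw [mul_comm 4]
    exact Nat.mul_le_mul_left _ h2
  nlinarith

/-- One round can be eliminated from a protocol for exists-equal. -/
theorem exists_restriction {n t n' t' c m s e q K B : ℕ} [NeZero t] [NeZero t']
    (hq : t = 2 ^ s * q) (hqK : q = K * t') (htq : t' < q) (hK : (K : ℝ) = (2 ^ m) ^ 2)
    (hB : (B : ℝ) = 2 ^ s * (K * (1 - 1 / 2 ^ m))) (hn : n' * B = n - e) (he : e ≤ n)
    (hse : n + (c + 1 + m) < s * e) (msg : (Fin n → Fin t) → Msg c)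
    (p : Msg c → (Fin n → Fin t) → (Fin n → Fin t) → Bool)
    {ε : ℝ} (hε1 : ε + 1 / 2 ^ m ≤ 1) (hε : averageError (fun x y => p (msg x) x y) ≤ ε) :
    ∃ (w : Msg c) (f h : (Fin n' → Fin t') → Fin n → Fin t),
      averageError (fun u v => p w (f u) (h v)) ≤ ε + 1 / 2 ^ m + e / t +
        n' * ((2 ^ m + K * (1 / 2 ^ m)) / q + (K / q : ℝ) ^ 2) := by
  obtain ⟨w, S, hS, hScard⟩ := exists_message_class msg
    (fun x => 𝔼 y, if p (msg x) x y ≠ existsEqual _ _ x y then (1 : ℝ) else 0)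
    (fun x => Finset.expect_nonneg fun y _ => by split_ifs <;> norm_num) m hε hε1
  have hnN : n - (n - e) = e := by omega
  have hqt : q ≤ t := by
    rw [hq]
    exact Nat.le_mul_of_pos_left q (by positivity)
  have hq0 : 0 < q := by omega
  -- Since `t = 2 ^ s * q`, each of the `e` lost levels gains `2 ^ s`; `hse` makes this beat the
  -- number of patterns and the sparsity of `S`.
  have hlarge : 2 ^ n * (Fintype.card (Fin t) ^ (n - e) * q ^ (n - (n - e))) < S.card := by
    rw [hnN, Fintype.card_fin]
    have h1 : Fintype.card (Fin n → Fin t) = t ^ (n - e) * q ^ e * 2 ^ (s * e) := by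
      rw [Fintype.card_fun, Fintype.card_fin, Fintype.card_fin, pow_mul, mul_assoc, ← mul_pow,
        mul_comm q, ← hq, ← pow_add]
      congr 1
      omega
    rw [h1] at hScard
    set Q := t ^ (n - e) * q ^ e with hQ
    have hQ0 : 0 < Q := Nat.mul_pos (Nat.pow_pos (by omega)) (Nat.pow_pos hq0)
    have h5 : Q * 2 ^ (n + (c + 1 + m)) < Q * 2 ^ (s * e) :=
      Nat.mul_lt_mul_of_pos_left (Nat.pow_lt_pow_right (by norm_num) hse) hQ0
    have h6 : 2 ^ n * Q * 2 ^ (c + 1 + m) < S.card * 2 ^ (c + 1 + m) := by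
      refine lt_of_lt_of_le ?_ hScard
      refine lt_of_eq_of_lt ?_ h5
      rw [pow_add 2 n]
      ring
    exact lt_of_mul_lt_mul_right h6 (Nat.zero_le _)
  obtain ⟨pat, hpat, hsh⟩ := exists_shatters (Nat.sub_le n e) (by rw [Fintype.card_fin]; exact hqt)
    S hlarge
  obtain ⟨C, -, hCq⟩ := Finset.exists_subset_card_eq (s := (Finset.univ : Finset (Fin t)))
    (n := q) (by rw [Finset.card_univ, Fintype.card_fin]; exact hqt)
  have hη0 : (0 : ℝ) < 2 ^ m := by positivity
  have hBs : (B : ℝ) * (C.card / Fintype.card (Fin t)) = K * (1 - 1 / 2 ^ m) := by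
    rw [hCq, Fintype.card_fin, hB, hq]
    have : (q : ℝ) ≠ 0 := by exact_mod_cast hq0.ne'
    push_cast
    field_simp
  have hle : t' ≤ t := by omega
  obtain ⟨f, h, hfh⟩ := exists_embedding (Fin.castLE_injective hle) (C := C)
    (by rw [hCq, Fintype.card_fin]; exact htq) (K := K) (B := B)
    (by rw [hCq, Fintype.card_fin]; exact hqK) (l := 2 ^ m) (η := 1 / 2 ^ m) hη0 hK
    (by
      rw [hBs]
      refine mul_le_of_le_one_right (by positivity) ?_
      have : (0 : ℝ) ≤ 1 / 2 ^ m := by positivity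
      linarith)
    hBs.ge (n' := n') (b := pat) (S := (S : Set _)) (by rw [hCq]; exact hsh)
    (by rw [hn]; exact hpat) (p w) (ε := ε + 1 / 2 ^ m)
    (fun x hx => by
      have := (hS x hx).2
      rw [(hS x hx).1] at this
      exact this)
  refine ⟨w, f, h, hfh.trans (le_of_eq ?_)⟩
  rw [hn, hnN, hCq, Fintype.card_fin]

/-- The choices are `e = n / 2 ^ m`, `K = 4 ^ m`, `q = K * t'`, `t / q = 2 ^ s`, and `B` such that
the mean number of hits is `K * (1 - 1 / 2 ^ m)`. In units of `1 / 2 ^ m`, the losses are 1 for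
Markov, 1/2 for the lost levels and at most 5/4 for the blocks. -/
theorem exists_restriction_two_pow {m k b c : ℕ} (hm : 2 ≤ m)
    (hb : b = 2 ^ m * (2 ^ m + 4) + 2 * m) (hk : b + m ≤ k)
    (hc : c ≤ 2 ^ (m + k)) (msg : (Fin (2 ^ k) → Fin (2 ^ (k + 1))) → Msg c)
    (p : Msg c → (Fin (2 ^ k) → Fin (2 ^ (k + 1))) → (Fin (2 ^ k) → Fin (2 ^ (k + 1))) → Bool)
    {ε : ℝ} (hε1 : ε + 1 / 2 ^ m ≤ 1) (hε : averageError (fun x y => p (msg x) x y) ≤ ε) :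
    ∃ (w : Msg c) (f h : (Fin (2 ^ (k - b)) → Fin (2 ^ (k - b + 1))) →
      Fin (2 ^ k) → Fin (2 ^ (k + 1))),
      averageError (fun u v => p w (f u) (h v)) ≤ ε + 3 / 2 ^ m := by
  obtain ⟨s, hs⟩ : ∃ s, s = 2 ^ m * (2 ^ m + 4) := ⟨_, rfl⟩
  rw [← hs] at hb
  obtain ⟨k', hk'⟩ : ∃ k', k' = k - b := ⟨_, rfl⟩
  rw [← hk']
  have hn : 2 ^ (k - m) * 2 ^ m = 2 ^ k := by
    rw [← pow_add]
    congr 1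
    omega
  have hse : 2 ^ k + (c + 1 + m) < s * 2 ^ (k - m) := by
    have h2 : s * 2 ^ (k - m) = 2 ^ k * 2 ^ m + 2 ^ k * 4 := by
      rw [hs, ← hn]
      ring
    have h4 : k < 2 ^ k := Nat.lt_two_pow_self
    rw [pow_add, mul_comm] at hc
    rw [h2]
    omega
  have hBr : ((2 ^ b - 2 ^ (b - m) : ℕ) : ℝ) =
      2 ^ s * ((2 ^ (2 * m) : ℕ) * (1 - 1 / 2 ^ m)) := by
    have h1 : (2 : ℝ) ^ b = 2 ^ (b - m) * 2 ^ m := by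
      rw [← pow_add]
      congr 1
      omega
    have h2 : (2 : ℝ) ^ b = 2 ^ s * 2 ^ (2 * m) := by rw [hb, pow_add]
    rw [Nat.cast_sub (Nat.pow_le_pow_right (by norm_num) (by omega))]
    push_cast
    rw [← mul_assoc, ← h2, h1]
    field_simp
  obtain ⟨w, f, h, hfh⟩ := exists_restriction (n := 2 ^ k) (t := 2 ^ (k + 1)) (n' := 2 ^ k')
    (t' := 2 ^ (k' + 1)) (c := c) (m := m) (s := s) (e := 2 ^ (k - m)) (q := 2 ^ (k' + 2 * m + 1))
    (K := 2 ^ (2 * m)) (B := 2 ^ b - 2 ^ (b - m))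
    (by
      rw [← pow_add]
      congr 1
      omega)
    (by
      rw [← pow_add]
      congr 1
      omega)
    (Nat.pow_lt_pow_right (by norm_num) (by omega))
    (by
      push_cast
      rw [← pow_mul, mul_comm])
    hBr
    (by
      rw [Nat.mul_sub, ← pow_add, ← pow_add]
      congr 2 <;> omega)
    (Nat.pow_le_pow_right (by norm_num) (by omega)) hse msg p hε1 hε
  refine ⟨w, f, h, hfh.trans ?_⟩
  have hk2 : (2 : ℝ) ^ m ≤ 2 ^ k' := pow_le_pow_right₀ (by norm_num) (by omega)
  have hqr : ((2 ^ (k' + 2 * m + 1) : ℕ) : ℝ) = 2 * 2 ^ k' * (2 ^ m) ^ 2 := by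
    push_cast
    rw [pow_add, pow_add, pow_mul' 2 2 m]
    ring
  have hen' : ((2 ^ (k - m) : ℕ) : ℝ) / (2 ^ (k + 1) : ℕ) = 1 / (2 * 2 ^ m) := by
    have h2 : ((2 ^ (k + 1) : ℕ) : ℝ) = 2 * (2 ^ (k - m) * 2 ^ m) := by
      rw [pow_succ, ← hn]
      push_cast
      ring
    rw [h2]
    push_cast
    field_simp
  have hK : ((2 ^ (2 * m) : ℕ) : ℝ) = (2 ^ m) ^ 2 := by
    push_cast
    rw [← pow_mul, mul_comm]
  have hn' : ((2 ^ k' : ℕ) : ℝ) = 2 ^ k' := by push_cast; rfl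
  rw [hen', hK, hqr, hn']
  have ha0 : (0 : ℝ) < 2 ^ m := by positivity
  generalize (2 : ℝ) ^ m = a at *
  generalize (2 : ℝ) ^ k' = N at *
  have hN0 : 0 < N := by linarith
  have h1 : N * ((a + a ^ 2 * (1 / a)) / (2 * N * a ^ 2) + (a ^ 2 / (2 * N * a ^ 2)) ^ 2) =
      1 / a + 1 / (4 * N) := by
    field_simp
    ring
  rw [h1]
  have h2 : 1 / (4 * N) ≤ 1 / (4 * a) := by
    apply one_div_le_one_div_of_le <;> linarith
  have h3 : 1 / (4 * a) = 1 / 4 * (1 / a) := by field_simp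
  have h4 : 1 / (2 * a) = 1 / 2 * (1 / a) := by field_simp
  have h5 : 3 / a = 3 * (1 / a) := by ring
  have h6 : 0 < 1 / a := by positivity
  rw [h4, h5]
  linarith

/-- The exponent of a number of coordinates on which `r` rounds with messages of `2 ^ m` bits per
coordinate do not suffice. -/
def sizeExponent : ℕ → ℕ → ℕ
  | 0, _ => 0
  | r + 1, m => 8 ^ m + sizeExponent r (8 ^ m)

/-- The reserve `6 / 2 ^ m` pays `3 / 2 ^ m` for the round removed and leaves at least `6 / 2 ^ 8 ^
m` for the later ones. -/
theorem lt_averageError (r : ℕ) : ∀ {m k c : ℕ}, 7 ≤ m → c ≤ 2 ^ (m + k) → sizeExponent r m ≤ k →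
    ∀ P : DetProtocol (Fin (2 ^ k) → Fin (2 ^ (k + 1))) c r,
      (39 / 100 - 6 / 2 ^ m : ℝ) < averageError P.run := by
  have hout : ∀ {m k : ℕ} (g : (Fin (2 ^ k) → Fin (2 ^ (k + 1))) → Bool),
      (39 / 100 - 6 / 2 ^ m : ℝ) <
        averageError fun x (_ : Fin (2 ^ k) → Fin (2 ^ (k + 1))) => g x := by
    intro m k g
    have h1 := lt_averageError_of_output (n := 2 ^ k) (t := 2 ^ (k + 1)) (by positivity)
      (by rw [pow_succ, mul_comm]) g
    have h2 : (0 : ℝ) < 6 / 2 ^ m := by positivity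
    linarith
  induction r with
  | zero =>
    intro m k c hm hc hk P
    cases P with
    | output g => exact hout g
  | succ r ih =>
    intro m k c hm hc hk P
    cases P with
    | output g => exact hout g
    | speak msg next =>
      by_contra! hcon
      have hb := eight_pow_bound (m := m) (by omega)
      set b := 2 ^ m * (2 ^ m + 4) + 2 * m with hbdef
      have hk' : 8 ^ m + sizeExponent r (8 ^ m) ≤ k := hk
      have h2m : (128 : ℝ) ≤ 2 ^ m := by
        calc (128 : ℝ) = 2 ^ 7 := by norm_num
          _ ≤ 2 ^ m := pow_le_pow_right₀ (by norm_num) hm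
      have hm0 : (0 : ℝ) < 2 ^ m := by positivity
      obtain ⟨w, f, h, hfh⟩ := exists_restriction_two_pow (by omega) hbdef (by omega) hc msg
        (fun w x y => (next w).run y x) (ε := 39 / 100 - 6 / 2 ^ m) (by
          have h1 : (6 : ℝ) / 2 ^ m = 6 * (1 / 2 ^ m) := by ring
          have h2 : (0 : ℝ) < 1 / 2 ^ m := by positivity
          linarith) hcon
      have hlow := ih (m := 8 ^ m) (k := k - b) (c := c)
        (by
          calc 7 ≤ m := hm
            _ ≤ 8 ^ m := (Nat.lt_pow_self (by norm_num)).le)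
        (hc.trans (Nat.pow_le_pow_right (by norm_num) (by omega))) (by omega)
        ((next w).comap h f)
      -- After the deleted message the other player moves, so the embeddings change places; the game
      -- is symmetric.
      have hswap : averageError ((next w).comap h f).run =
          averageError fun u v => (next w).run (h v) (f u) := by
        unfold averageError
        rw [Finset.expect_comm]
        refine Finset.expect_congr rfl fun u _ => Finset.expect_congr rfl fun v _ => ?_
        rw [DetProtocol.run_comap, existsEqual_comm]
      rw [hswap] at hlow
      have h3 : (6 : ℝ) / 2 ^ 8 ^ m ≤ 3 / 2 ^ m := by
        have h4 : (2 : ℝ) ^ (m + 1) ≤ 2 ^ 8 ^ m :=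
          pow_le_pow_right₀ (by norm_num) (Nat.lt_pow_self (by norm_num))
        calc (6 : ℝ) / 2 ^ 8 ^ m ≤ 6 / 2 ^ (m + 1) := by gcongr
          _ = 3 / 2 ^ m := by
            rw [pow_succ]
            field_simp
            norm_num
      have h5 : (6 : ℝ) / 2 ^ m = 3 / 2 ^ m + 3 / 2 ^ m := by ring
      linarith

/-! ### Randomized protocols -/

theorem measurableSet_out_ne {X : Type} {c r : ℕ} (P : RandProtocol.{u} X c r) (x y : X)
    (v : Bool) : MeasurableSet {ω | P.out ω x y ≠ v} := by
  have h : MeasurableSet {ω | P.out ω x y = true} := by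
    unfold RandProtocol.out
    cases P.aliceFirst
    · simpa using P.measurable_run y x
    · simpa using P.measurable_run x y
  cases v
  · convert h using 2
    ext ω
    simp
  · exact h.compl

/-- Some choice of the coins has at most the error of the protocol, on average over any family of
pairs of inputs. -/
theorem exists_coins {X : Type} {c r : ℕ} (P : RandProtocol.{u} X c r) {F : X → X → Bool} {ε : ℝ}
    (hP : P.HasError F ε) {I : Type} [Fintype I] [Nonempty I] (x y : I → X) :
    ∃ ω, (𝔼 i, if P.out ω (x i) (y i) ≠ F (x i) (y i) then (1 : ℝ) else 0) ≤ ε := by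
  have hI : (0 : ℝ) < Fintype.card I := by exact_mod_cast Fintype.card_pos
  have hind : ∀ i, (fun ω => if P.out ω (x i) (y i) ≠ F (x i) (y i) then (1 : ℝ) else 0) =
      {ω | P.out ω (x i) (y i) ≠ F (x i) (y i)}.indicator fun _ => 1 := by
    intro i
    ext ω
    simp [Set.indicator_apply]
  have hmeas := fun i => measurableSet_out_ne P (x i) (y i) (F (x i) (y i))
  have hint : ∀ i, Integrable
      (fun ω => if P.out ω (x i) (y i) ≠ F (x i) (y i) then (1 : ℝ) else 0) P.law := by
    intro i
    rw [hind i]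
    exact (integrable_const _).indicator (hmeas i)
  obtain ⟨ω, hω⟩ := exists_le_integral
    (integrable_finsetSum Finset.univ fun i (_ : i ∈ Finset.univ) => hint i)
  refine ⟨ω, ?_⟩
  rw [Fintype.expect_eq_sum_div_card, div_le_iff₀ hI]
  refine hω.trans ?_
  rw [integral_finsetSum _ fun i _ => hint i]
  have hle : ∀ i ∈ Finset.univ, (∫ ω, (if P.out ω (x i) (y i) ≠ F (x i) (y i) then (1 : ℝ) else 0)
      ∂P.law) ≤ ε := by
    intro i _
    rw [hind i, integral_indicator_const (1 : ℝ) (hmeas i), smul_eq_mul, mul_one]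
    exact hP (x i) (y i)
  refine (Finset.sum_le_sum hle).trans ?_
  simp [mul_comm]

/-- The extension of a vector by a constant. -/
def padVec {n₀ n t₀ t : ℕ} (ht : t₀ ≤ t) (a : Fin t) (x : Fin n₀ → Fin t₀) (i : Fin n) : Fin t :=
  if h : (i : ℕ) < n₀ then Fin.castLE ht (x ⟨i, h⟩) else a

/-- The players pad with different constants, so the added coordinates never agree. -/
theorem existsEqual_padVec {n₀ n t₀ t : ℕ} (hn : n₀ ≤ n) (ht : t₀ ≤ t) {a b : Fin t} (hab : a ≠ b)
    (x y : Fin n₀ → Fin t₀) :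
    existsEqual t n (padVec ht a x) (padVec ht b y) = existsEqual t₀ n₀ x y := by
  unfold existsEqual padVec
  congr 1
  refine propext ⟨?_, ?_⟩
  · rintro ⟨i, hi⟩
    by_cases h : (i : ℕ) < n₀
    · simp only [h, dif_pos] at hi
      exact ⟨_, Fin.castLE_injective ht hi⟩
    · simp only [h, dif_neg, not_false_eq_true] at hi
      exact absurd hi hab
  · rintro ⟨i, hi⟩
    refine ⟨Fin.castLE hn i, ?_⟩
    simp [hi]

theorem exists_detProtocol {n c r k : ℕ} (hk : 2 ^ k ≤ n)
    (P : RandProtocol.{u} (Fin n → Fin (4 * n)) c r)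
    (hP : P.HasError (existsEqual (4 * n) n) (1 / 3)) :
    ∃ D : DetProtocol (Fin (2 ^ k) → Fin (2 ^ (k + 1))) c r, averageError D.run ≤ 1 / 3 := by
  have hn : 0 < n := lt_of_lt_of_le (by positivity) hk
  have ht : 2 ^ (k + 1) ≤ 4 * n := by
    rw [pow_succ]
    omega
  set a : Fin (4 * n) := ⟨0, by omega⟩
  set b : Fin (4 * n) := ⟨1, by omega⟩
  have hab : a ≠ b := by simp [a, b, Fin.ext_iff]
  obtain ⟨ω, hω⟩ := exists_coins P hP
    (I := (Fin (2 ^ k) → Fin (2 ^ (k + 1))) × (Fin (2 ^ k) → Fin (2 ^ (k + 1))))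
    (fun i => padVec ht a i.1) fun i => padVec ht b i.2
  simp only [existsEqual_padVec hk ht hab] at hω
  rw [← Finset.univ_product_univ, Finset.expect_product] at hω
  unfold RandProtocol.out at hω
  cases hal : P.aliceFirst
  · refine ⟨(P.det ω).comap (padVec ht b) (padVec ht a), le_trans (le_of_eq ?_) hω⟩
    unfold averageError
    rw [Finset.expect_comm]
    refine Finset.expect_congr rfl fun x _ => Finset.expect_congr rfl fun y _ => ?_
    rw [DetProtocol.run_comap, existsEqual_comm, hal]
    rfl
  · refine ⟨(P.det ω).comap (padVec ht a) (padVec ht b), le_trans (le_of_eq ?_) hω⟩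
    unfold averageError
    refine Finset.expect_congr rfl fun x _ => Finset.expect_congr rfl fun y _ => ?_
    rw [DetProtocol.run_comap, hal]
    rfl

/-! ### Iterated exponentials -/

/-- The `r`-fold iterate of the exponential to base 2. -/
def tower (r x : ℕ) : ℕ := (2 ^ ·)^[r] x

theorem tower_mono (r : ℕ) {x y : ℕ} (h : x ≤ y) : tower r x ≤ tower r y := by
  induction r generalizing x y with
  | zero => exact h
  | succ r ih => exact ih (Nat.pow_le_pow_right (by norm_num) h)

/-- The slack `2 * m` makes the induction close: the summand `8 ^ m` is absorbed by the slack at the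
next level, and `8 ^ m = 2 ^ (3 * m)`. -/
theorem sizeExponent_add_le (r m : ℕ) (hm : 1 ≤ m) :
    sizeExponent r m + 2 * m ≤ tower r (3 * m + 3) := by
  induction r generalizing m with
  | zero =>
    change 0 + 2 * m ≤ 3 * m + 3
    omega
  | succ r ih =>
    have h1 : 2 * m ≤ 8 ^ m := by
      obtain ⟨j, rfl⟩ : ∃ j, m = j + 1 := ⟨m - 1, by omega⟩
      have : j < 8 ^ j := Nat.lt_pow_self (by norm_num)
      rw [pow_succ]
      omega
    have h2 : 3 * 8 ^ m + 3 ≤ 2 ^ (3 * m + 3) := by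
      rw [pow_add, pow_mul]
      norm_num
      omega
    calc sizeExponent (r + 1) m + 2 * m ≤ sizeExponent r (8 ^ m) + 2 * 8 ^ m := by
          simp only [sizeExponent]
          omega
      _ ≤ tower r (3 * 8 ^ m + 3) := ih _ (by omega)
      _ ≤ tower r (2 ^ (3 * m + 3)) := tower_mono r h2
      _ = tower (r + 1) (3 * m + 3) := rfl

theorem logStar_le_of_lt_tower (r : ℕ) {x : ℝ} (h : x < tower r 2) : logStar x ≤ r := by
  suffices ∃ j ≤ r, iterLog j x < 2 by
    obtain ⟨j, hj, hx⟩ := this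
    exact (Nat.sInf_le (s := {r : ℕ | iterLog r x < 2}) hx).trans hj
  induction r generalizing x with
  | zero => exact ⟨0, le_rfl, by simpa [iterLog, tower] using h⟩
  | succ r ih =>
    by_cases hx : x < 2
    · exact ⟨0, by omega, by simpa [iterLog] using hx⟩
    · push Not at hx
      have hlog : Real.logb 2 x < tower r 2 := by
        rw [Real.logb_lt_iff_lt_rpow (by norm_num) (by linarith), Real.rpow_natCast]
        have : tower (r + 1) 2 = 2 ^ tower r 2 := by
          simp only [tower, Function.iterate_succ_apply']
        rw [this] at h
        exact_mod_cast h
      obtain ⟨j, hj, hjx⟩ := ih hlog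
      exact ⟨j + 1, by omega, hjx⟩

theorem le_tower (x : ℕ) : x ≤ tower x 2 := by
  induction x with
  | zero => exact Nat.zero_le _
  | succ x ih =>
    have : tower (x + 1) 2 = 2 ^ tower x 2 := by
      simp only [tower, Function.iterate_succ_apply']
    rw [this]
    exact lt_of_le_of_lt ih Nat.lt_two_pow_self

/-- For every constant `C` there is a constant `K` such that every randomized protocol for
exists-equal with parameters `n` and `t = 4n`, with error probability at most `1/3` and with
messages of at most `C * n` bits, has at least `logStar n - K` rounds. -/
theorem mainTheorem6 (C : ℝ) :
    ∃ K : ℕ, ∀ n : ℕ, 1 ≤ n → ∀ c r : ℕ, (c : ℝ) ≤ C * n →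
      ∀ P : RandProtocol.{u} (Fin n → Fin (4 * n)) c r,
        P.HasError (existsEqual (4 * n) n) (1 / 3) →
          (logStar (n : ℝ) : ℝ) - K ≤ r := by
  obtain ⟨m₀, hm₀⟩ := exists_nat_ge C
  -- One unit absorbs the factor 2 in `n < 2 ^ (k + 1)`, and `m ≥ 8` keeps `39/100 - 6 / 2 ^ m`
  -- above 1/3.
  set m := m₀ + 8 with hm
  -- A tower of `3 * m + 3` levels over 2 exceeds the starting value `3 * m + 3`; one more level
  -- passes from the exponent to `n`.
  refine ⟨3 * m + 4, fun n hn c r hc P hP => ?_⟩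
  have hnot : ¬ 2 ^ sizeExponent r m ≤ n := by
    intro hsize
    set k := Nat.log 2 n with hk
    have hk1 : 2 ^ k ≤ n := Nat.pow_log_le_self 2 (by omega)
    have hk2 : n < 2 ^ (k + 1) := Nat.lt_pow_succ_log_self (by norm_num) n
    have hrk : sizeExponent r m ≤ k := by
      have := (Nat.pow_lt_pow_iff_right (by norm_num : 1 < 2)).mp (lt_of_le_of_lt hsize hk2)
      omega
    have hcb : c ≤ 2 ^ (m + k) := by
      have h1 : (c : ℝ) ≤ (m₀ * n : ℕ) := by
        push_cast
        exact hc.trans (mul_le_mul_of_nonneg_right hm₀ (by positivity))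
      have h2 : c ≤ m₀ * n := by exact_mod_cast h1
      have h3 : m₀ ≤ 2 ^ m₀ := Nat.lt_two_pow_self.le
      calc c ≤ m₀ * n := h2
        _ ≤ 2 ^ m₀ * 2 ^ (k + 1) := Nat.mul_le_mul h3 hk2.le
        _ = 2 ^ (m₀ + (k + 1)) := (pow_add _ _ _).symm
        _ ≤ 2 ^ (m + k) := Nat.pow_le_pow_right (by norm_num) (by omega)
    obtain ⟨D, hD⟩ := exists_detProtocol hk1 P hP
    have hlow := lt_averageError r (by omega) hcb hrk D
    have h2m : (256 : ℝ) ≤ 2 ^ m := by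
      calc (256 : ℝ) = 2 ^ 8 := by norm_num
        _ ≤ 2 ^ m := pow_le_pow_right₀ (by norm_num) (by omega)
    have h6 : (6 : ℝ) / 2 ^ m ≤ 6 / 256 := by gcongr
    linarith
  have hlt : n < tower (r + (3 * m + 4)) 2 := by
    have h1 := sizeExponent_add_le r m (by omega)
    have h2 : 3 * m + 3 ≤ tower (3 * m + 3) 2 := le_tower _
    calc n < 2 ^ sizeExponent r m := by omega
      _ ≤ 2 ^ tower r (3 * m + 3) := Nat.pow_le_pow_right (by norm_num) (by omega)
      _ ≤ 2 ^ tower r (tower (3 * m + 3) 2) :=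
          Nat.pow_le_pow_right (by norm_num) (tower_mono r h2)
      _ = tower (r + (3 * m + 4)) 2 := by
          have e1 : r + (3 * m + 4) = (r + (3 * m + 3)) + 1 := by omega
          rw [e1]
          simp only [tower, Function.iterate_succ_apply', Function.iterate_add_apply]
  have hfin := logStar_le_of_lt_tower (r + (3 * m + 4)) (x := (n : ℝ)) (by exact_mod_cast hlt)
  have : (logStar (n : ℝ) : ℝ) ≤ ((r + (3 * m + 4) : ℕ) : ℝ) := by exact_mod_cast hfin
  push_cast at this ⊢
  linarith
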